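/- Let $n,k,d$ be integers with $1\le k\le n$ and $0\le d\le n$. The reflection arrangement of type $B_n$ consists of the hyperplanes $\{\beta_i=\beta_j\}$, $\{\beta_i=-\beta_j\}$ $(1\le i<j\le n)$ and $\{\beta_i=0\}$ $(1\le i\le n)$ in $\mathbb R^n$. Let $L\subset\mathbb R^n$ be a linear subspace of codimension $d$ in general position with respect to this arrangement, meaning that for every linear subspace $K$ that is an intersection of hyperplanes of the arrangement (the empty intersection being $\mathbb R^n$), $\dim(L\cap K)=\dim K-d$ if $\dim K\ge d$, and $\dim(L\cap K)=0$ if $\dim K\le d$. For $\varepsilon\in\{-1,+1\}^n$ and a permutation $\sigma$ of $\{1,\dots,n\}$ let $$C_{\varepsilon,\sigma}^B=\{\beta\in\mathbb R^n:\ \varepsilon_1\beta_{\sigma(1)}\ge\varepsilon_2\beta_{\sigma(2)}\ge\dots\ge\varepsilon_n\beta_{\sigma(n)}\ge 0\}$$ be the closed Weyl chambers of type $B_n$, and let $\mathcal F_k(C)$ denote the set of $k$-dimensional faces of a polyhedral cone $C$. Then $$\frac1{2^n n!}\sum_{\varepsilon\in\{-1,+1\}^n}\ \sum_{\sigma\in\mathrm{Sym}(n)}\#\{F\in\mathcal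 F_k(C_{\varepsilon,\sigma}^B):\ F\cap L=\{0\}\}=2\binom nk\frac{B(k,d-1)+B(k,d-3)+\dots}{2^k k!},$$ where the numbers $B(k,j)$ are defined by $(t+1)(t+3)\cdots(t+2k-1)=\sum_{j=0}^k B(k,j)t^j$ and $B(k,j)=0$ for $j<0$ and $j>k$. -/

import Mathlib

noncomputable section

namespace WeylB

/-- The hyperplanes `{β_i = β_j}`, `{β_i = -β_j}` (`i < j`) and `{β_i = 0}` of the reflection
arrangement of type `B_n`. -/
def reflectionArrangement (n : ℕ) : Set (Submodule ℝ (Fin n → ℝ)) :=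
  {H | (∃ i j : Fin n, i < j ∧
          H = LinearMap.ker (LinearMap.proj (R := ℝ) (φ := fun _ : Fin n => ℝ) i
            - LinearMap.proj j)) ∨
       (∃ i j : Fin n, i < j ∧
          H = LinearMap.ker (LinearMap.proj (R := ℝ) (φ := fun _ : Fin n => ℝ) i
            + LinearMap.proj j)) ∨
       (∃ i : Fin n, H = LinearMap.ker (LinearMap.proj (R := ℝ) (φ := fun _ : Fin n => ℝ) i))}

/-- The lattice generated by the reflection arrangement: all intersections of its hyperplanes
(the empty intersection is the whole space). -/
def arrangementLattice (n : ℕ) : Set (Submodule ℝ (Fin n → ℝ)) :=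
  {K | ∃ S ⊆ reflectionArrangement n, K = sInf S}

/-- `L`, of codimension `d`, is in general position with respect to the reflection arrangement. -/
def InGeneralPosition {n : ℕ} (L : Submodule ℝ (Fin n → ℝ)) (d : ℕ) : Prop :=
  ∀ K ∈ arrangementLattice n,
    (d ≤ Module.finrank ℝ K → (Module.finrank ℝ ↥(L ⊓ K) : ℤ) = (Module.finrank ℝ K : ℤ) - d) ∧
    (Module.finrank ℝ K ≤ d → Module.finrank ℝ ↥(L ⊓ K) = 0)

/-- The closed Weyl chamber
`{β : ε₁ β_{σ(1)} ≥ ε₂ β_{σ(2)} ≥ … ≥ ε_n β_{σ(n)} ≥ 0}` of type `B_n`, as a convex cone.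
The signs `ε_i ∈ {-1, +1}` are the units of `ℤ`. -/
def chamber {n : ℕ} (ε : Fin n → ℤˣ) (σ : Equiv.Perm (Fin n)) : PointedCone ℝ (Fin n → ℝ) where
  carrier := {β | (∀ i j : Fin n, i ≤ j →
      ((ε j : ℤ) : ℝ) * β (σ j) ≤ ((ε i : ℤ) : ℝ) * β (σ i)) ∧
    ∀ i : Fin n, 0 ≤ ((ε i : ℤ) : ℝ) * β (σ i)}
  add_mem' := by
    rintro x y ⟨hx, hx'⟩ ⟨hy, hy'⟩
    refine ⟨fun i j hij => ?_, fun i => ?_⟩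
    · have h1 := hx i j hij
      have h2 := hy i j hij
      simp only [Pi.add_apply, mul_add]
      linarith
    · have h1 := hx' i
      have h2 := hy' i
      simp only [Pi.add_apply, mul_add]
      linarith
  zero_mem' := by simp
  smul_mem' := by
    rintro ⟨c, hc⟩ x ⟨hx, hx'⟩
    refine ⟨fun i j hij => ?_, fun i => ?_⟩
    · have h := mul_le_mul_of_nonneg_left (hx i j hij) hc
      simpa [NNReal.smul_def, mul_left_comm] using h
    · have h := mul_nonneg hc (hx' i)
      simpa [NNReal.smul_def, mul_left_comm] using h

/-- The set of `k`-dimensional faces of a convex cone; the dimension of a face is the dimension of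
its linear hull. -/
def faces {n : ℕ} (k : ℕ) (Q : PointedCone ℝ (Fin n → ℝ)) : Set (PointedCone ℝ (Fin n → ℝ)) :=
  {F | F.IsFaceOf Q ∧ Module.finrank ℝ (Submodule.span ℝ (F : Set (Fin n → ℝ))) = k}

/-- A polyhedral cone has finitely many faces. -/
theorem finite_isFaceOf {n : ℕ} {ι : Type} [Finite ι] (f : ι → (Fin n → ℝ) →ₗ[ℝ] ℝ)
    (Q : PointedCone ℝ (Fin n → ℝ)) (hQ : ∀ x, x ∈ Q ↔ ∀ i, 0 ≤ f i x) :
    {F : PointedCone ℝ (Fin n → ℝ) | F.IsFaceOf Q}.Finite := by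
  classical
  cases nonempty_fintype ι
  have key : ∀ F₁ F₂ : PointedCone ℝ (Fin n → ℝ), F₁.IsFaceOf Q → F₂.IsFaceOf Q →
      {i | ∀ x ∈ F₁, f i x = 0} = {i | ∀ x ∈ F₂, f i x = 0} → F₁ ≤ F₂ := by
    intro F₁ F₂ h₁ h₂ h y hy
    have hyQ := h₁.le hy
    have hch : ∀ i, ∃ x ∈ F₂, f i y ≠ 0 → 0 < f i x := by
      intro i
      by_cases hi : f i y = 0
      · exact ⟨0, F₂.zero_mem, fun h => absurd hi h⟩
      · have : i ∉ {i | ∀ x ∈ F₂, f i x = 0} := by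
          rw [← h]
          exact fun hc => hi (hc y hy)
        simp only [Set.mem_ofPred_eq, not_forall] at this
        obtain ⟨x, hx, hne⟩ := this
        exact ⟨x, hx, fun _ => lt_of_le_of_ne ((hQ x).1 (h₂.le hx) i) (Ne.symm hne)⟩
    choose x hx hpos using hch
    have hzF : ∑ i, x i ∈ F₂ := Submodule.sum_mem _ fun i _ => hx i
    have hz : ∀ i, f i (x i) ≤ f i (∑ j, x j) := by
      intro i
      rw [map_sum]
      exact Finset.single_le_sum (f := fun j => f i (x j))
        (fun j _ => (hQ _).1 (h₂.le (hx j)) i) (Finset.mem_univ i)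
    have hev : ∀ᶠ c : ℝ in nhdsWithin 0 (Set.Ioi 0), ∀ i, 0 ≤ f i (∑ j, x j) - c * f i y := by
      rw [Filter.eventually_all]
      intro i
      by_cases hi : f i y = 0
      · simp only [hi, mul_zero, sub_zero]
        exact Filter.Eventually.of_forall fun _ => (hQ _).1 (h₂.le hzF) i
      · have h0 : 0 < f i (∑ j, x j) := lt_of_lt_of_le (hpos i hi) (hz i)
        have ht : Filter.Tendsto (fun c : ℝ => f i (∑ j, x j) - c * f i y)
            (nhdsWithin 0 (Set.Ioi 0)) (nhds (f i (∑ j, x j) - 0 * f i y)) :=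
          (Continuous.tendsto (by fun_prop) 0).mono_left nhdsWithin_le_nhds
        rw [zero_mul, sub_zero] at ht
        filter_upwards [ht.eventually (lt_mem_nhds h0)] with c hc using hc.le
    obtain ⟨c, hc, hc0⟩ := (hev.and self_mem_nhdsWithin).exists
    have hc0' : (0 : ℝ) < c := hc0
    refine h₂.mem_of_smul_add_mem (y := ∑ j, x j - c • y) hyQ ?_ hc0' ?_
    · rw [hQ]
      intro i
      simpa using hc i
    · simpa using hzF
  refine Set.Finite.of_finite_image (f := fun F : PointedCone ℝ (Fin n → ℝ) =>
    {i | ∀ x ∈ F, f i x = 0}) (Set.toFinite _) ?_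
  intro F₁ h₁ F₂ h₂ h
  exact le_antisymm (key _ _ h₁ h₂ h) (key _ _ h₂ h₁ h.symm)

/-- The set of `k`-faces of a Weyl chamber is finite, so that counting them by `Set.ncard` is
meaningful. -/
theorem finite_faces_chamber {n : ℕ} (k : ℕ) (ε : Fin n → ℤˣ) (σ : Equiv.Perm (Fin n)) :
    (faces k (chamber ε σ)).Finite := by
  let g : Fin n → (Fin n → ℝ) →ₗ[ℝ] ℝ := fun i => ((ε i : ℤ) : ℝ) • LinearMap.proj (σ i)
  refine (finite_isFaceOf (ι := {p : Fin n × Fin n // p.1 ≤ p.2} ⊕ Fin n)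
    (Sum.elim (fun p => g p.1.1 - g p.1.2) g) (chamber ε σ) ?_).subset fun F hF => hF.1
  intro x
  change (_ ∧ _) ↔ _
  simp [g, Sum.forall]

/-- The number of `k`-dimensional faces `F` of the cone `Q` with `F ∩ L = {0}`. -/
def numTrivialFaces {n : ℕ} (k : ℕ) (L : Submodule ℝ (Fin n → ℝ))
    (Q : PointedCone ℝ (Fin n → ℝ)) : ℕ :=
  {F ∈ faces k Q | (F : Set (Fin n → ℝ)) ∩ (L : Set (Fin n → ℝ)) = {0}}.ncard

/-- The coefficients `B(k, j)` given by `(t+1)(t+3)⋯(t+2k-1) = ∑_j B(k, j) t^j`, with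
`B(k, j) = 0` for `j < 0` (and automatically for `j > k`). -/
def B (k : ℕ) (j : ℤ) : ℕ :=
  if 0 ≤ j then
    (∏ i ∈ Finset.range k,
      ((Polynomial.X : Polynomial ℕ) + Polynomial.C (2 * i + 1))).coeff j.toNat
  else 0

end WeylB

end

noncomputable section

namespace WeylB

open Module

/-! Every `k`-face of a chamber is a copy of the standard chamber of type `B_k` inside a
`k`-dimensional flat: choosing which `k` of the gaps between consecutive signed coordinates may be
nonzero groups the coordinates into `k` blocks of equal absolute value and a tail of zeros
(`mem_coneFace_gapForm_iff`). Permuting and re-signing the blocks permutes the terms of the sum over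
all chambers and faces. Averaging over these `2^k k!` symmetries (`card_mul_sum_numTrivialFaces`)
replaces each indicator by the proportion of `B_k`-chambers which meet the preimage of `L` in `ℝ^k`
only at the origin. That preimage is again in general position with the same `d`, so the proportion
is the same for all faces, and it remains to count in `ℝ^k`.

By general position, a chamber that meets `L` outside the origin has an interior that meets `L`, so
the chambers met nontrivially correspond to the regions cut out on `L`. Regions are counted by
deletion and restriction along the `2k+1` hyperplanes of `B_{k+1}` that involve the last coordinate.
Any two of these intersect inside a hyperplane of `B_k`, so each of them contributes one region
count of type `B_k` with the same `d`; deleting them all leaves `B_k` on the projection of `L`, with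
`d - 1` in place of `d`. This is the recursion `B(k+1,j) = B(k,j-1) + (2k+1) B(k,j)`, and since
`2^(k+1) (k+1)! = (1 + (2k+1)) 2^k k!`, induction gives `ncard_meetingChambers_add`. -/

/-- Two maps with the same fibres on `s` have equally large images of `s`. -/
theorem ncard_image_eq_of_iff {X α β : Type*} {s : Set X} {f : X → α} {g : X → β}
    (h : ∀ x ∈ s, ∀ y ∈ s, f x = f y ↔ g x = g y) : (f '' s).ncard = (g '' s).ncard := by
  classical
  have hx : ∀ a : f '' s, ∃ x ∈ s, f x = a := fun a => a.2
  choose x hxs hxa using hx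
  refine Set.ncard_congr (fun a ha => g (x ⟨a, ha⟩)) (fun a ha => ⟨_, hxs _, rfl⟩) ?_ ?_
  · intro a b ha hb hab
    have := (h _ (hxs ⟨a, ha⟩) _ (hxs ⟨b, hb⟩)).2 hab
    rwa [hxa, hxa] at this
  · rintro _ ⟨y, hy, rfl⟩
    refine ⟨f y, ⟨y, hy, rfl⟩, ?_⟩
    exact (h _ (hxs _) _ hy).1 (hxa _)

/-! ### Regions of an arrangement restricted to a subspace; deletion and restriction. -/

section Regions

variable {E : Type*} [AddCommGroup E] [Module ℝ E]

/-- The linear forms of `S` which are positive at `x`. -/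
def posForms (S : Set (Dual ℝ E)) (x : E) : Set (Dual ℝ E) := {l ∈ S | 0 < l x}

/-- The points of `L` at which no form of `S` vanishes. -/
def genericPoints (S : Set (Dual ℝ E)) (L : Submodule ℝ E) : Set E :=
  {x | x ∈ L ∧ ∀ l ∈ S, l x ≠ 0}

/-- The regions into which the hyperplanes `l = 0`, `l ∈ S`, cut the subspace `L`; a region is
represented by the set of forms which are positive on it. -/
def regions (S : Set (Dual ℝ E)) (L : Submodule ℝ E) : Set (Set (Dual ℝ E)) :=
  posForms S '' genericPoints S L

theorem finite_image_posForms {S : Set (Dual ℝ E)} (hS : S.Finite) (s : Set E) :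
    (posForms S '' s).Finite := by
  refine hS.finite_subsets.subset ?_
  rintro _ ⟨x, -, rfl⟩
  exact Set.sep_subset _ _

theorem pos_iff_of_posForms_eq {S : Set (Dual ℝ E)} {x y : E} (h : posForms S x = posForms S y)
    {l : Dual ℝ E} (hl : l ∈ S) : 0 < l x ↔ 0 < l y := by
  have : l ∈ posForms S x ↔ l ∈ posForms S y := by rw [h]
  simpa [posForms, hl] using this

theorem posForms_eq_iff {S : Set (Dual ℝ E)} {x y : E} :
    posForms S x = posForms S y ↔ ∀ l ∈ S, (0 < l x ↔ 0 < l y) :=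
  ⟨fun h _ hl => pos_iff_of_posForms_eq h hl, fun h => by
    ext l
    simp only [posForms, Set.mem_ofPred_eq]
    exact and_congr_right fun hl => h l hl⟩

/-- A region of `S` in `L` that meets both sides of `h = 0` meets `h = 0`, and conversely. -/
theorem image_posForms_inter (S : Set (Dual ℝ E)) (hS : S.Finite) (L : Submodule ℝ E)
    (h : Dual ℝ E) (hL : ∃ x ∈ L, h x ≠ 0) :
    posForms S '' {x ∈ genericPoints S L | 0 < h x} ∩
        posForms S '' {x ∈ genericPoints S L | h x < 0} =
      regions S (L ⊓ LinearMap.ker h) ∧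
    posForms S '' {x ∈ genericPoints S L | 0 < h x} ∪
        posForms S '' {x ∈ genericPoints S L | h x < 0} = regions S L := by
  obtain ⟨v, hvL, hv⟩ : ∃ v ∈ L, 0 < h v := by
    obtain ⟨x, hx, hne⟩ := hL
    rcases lt_or_gt_of_ne hne with h0 | h0
    · exact ⟨-x, L.neg_mem hx, by simpa using h0⟩
    · exact ⟨x, hx, h0⟩
  -- A small push in any direction changes no sign of the finitely many forms at a generic point.
  have key : ∀ x ∈ genericPoints S L, ∀ w : E, ∃ c : ℝ, 0 < c ∧
      ∀ l ∈ S, l (x + c • w) ≠ 0 ∧ (0 < l (x + c • w) ↔ 0 < l x) := by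
    intro x hx w
    have hev : ∀ᶠ c : ℝ in nhdsWithin 0 (Set.Ioi 0), ∀ l ∈ S,
        l (x + c • w) ≠ 0 ∧ (0 < l (x + c • w) ↔ 0 < l x) := by
      rw [Filter.eventually_all_finite hS]
      intro l hl
      have ht : Filter.Tendsto (fun c : ℝ => l (x + c • w)) (nhdsWithin 0 (Set.Ioi 0))
          (nhds (l x)) := by
        have : Filter.Tendsto (fun c : ℝ => l x + c * l w) (nhdsWithin 0 (Set.Ioi 0))
            (nhds (l x + 0 * l w)) :=
          (Continuous.tendsto (by fun_prop) 0).mono_left nhdsWithin_le_nhds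
        simpa using this
      rcases lt_or_gt_of_ne (hx.2 l hl) with h0 | h0
      · filter_upwards [ht.eventually (gt_mem_nhds h0)] with c hc
        exact ⟨hc.ne, by constructor <;> intro <;> linarith⟩
      · filter_upwards [ht.eventually (lt_mem_nhds h0)] with c hc
        exact ⟨hc.ne', by constructor <;> intro <;> linarith⟩
    obtain ⟨c, hc, hc0⟩ := (hev.and self_mem_nhdsWithin).exists
    exact ⟨c, hc0, hc⟩
  have move : ∀ x ∈ genericPoints S L, h x = 0 →
      posForms S x ∈ posForms S '' {x ∈ genericPoints S L | 0 < h x} ∧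
      posForms S x ∈ posForms S '' {x ∈ genericPoints S L | h x < 0} := by
    intro x hx h0
    obtain ⟨c, hc, hcl⟩ := key x hx v
    obtain ⟨c', hc', hcl'⟩ := key x hx (-v)
    refine ⟨⟨x + c • v, ⟨⟨L.add_mem hx.1 (L.smul_mem _ hvL), fun l hl => (hcl l hl).1⟩, ?_⟩,
        posForms_eq_iff.2 fun l hl => (hcl l hl).2⟩,
      ⟨x + c' • -v, ⟨⟨L.add_mem hx.1 (L.smul_mem _ (L.neg_mem hvL)), fun l hl => (hcl' l hl).1⟩,
        ?_⟩, posForms_eq_iff.2 fun l hl => (hcl' l hl).2⟩⟩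
    · simpa [h0] using mul_pos hc hv
    · simpa [h0] using mul_pos hc' hv
  constructor
  · ext P
    constructor
    · rintro ⟨⟨x, ⟨hx, hx0⟩, rfl⟩, ⟨y, ⟨hy, hy0⟩, hyx⟩⟩
      rw [posForms_eq_iff] at hyx
      -- Both coefficients `h x` and `-h y` are positive, so this is the point where the ray of
      -- positive combinations of `x` and `y` lies on `h = 0`; it keeps the signs which `x` and `y`
      -- share.
      have hpos : ∀ l ∈ S, l (h x • y - h y • x) ≠ 0 ∧
          (0 < l (h x • y - h y • x) ↔ 0 < l x) := by
        intro l hl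
        simp only [map_sub, map_smul, smul_eq_mul]
        have := hyx l hl
        rcases lt_or_gt_of_ne (hx.2 l hl) with h1 | h1
        · have h2 : l y < 0 := lt_of_le_of_ne (by
            by_contra hc
            have := this.1 (by linarith)
            linarith) (hy.2 l hl)
          have : h x * l y - h y * l x < 0 := by
            nlinarith [mul_pos hx0 (neg_pos.2 h2), mul_pos (neg_pos.2 hy0) (neg_pos.2 h1)]
          exact ⟨this.ne, by constructor <;> intro <;> linarith⟩
        · have h2 := this.2 h1
          have : 0 < h x * l y - h y * l x := by
            nlinarith [mul_pos hx0 h2, mul_pos (neg_pos.2 hy0) h1]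
          exact ⟨this.ne', by constructor <;> intro <;> linarith⟩
      refine ⟨h x • y - h y • x, ⟨⟨L.sub_mem (L.smul_mem _ hy.1) (L.smul_mem _ hx.1), ?_⟩,
        fun l hl => (hpos l hl).1⟩, posForms_eq_iff.2 fun l hl => (hpos l hl).2⟩
      simp [mul_comm]
    · rintro ⟨x, ⟨⟨hxL, hx0⟩, hx⟩, rfl⟩
      exact move x ⟨hxL, hx⟩ hx0
  · ext P
    constructor
    · rintro (⟨x, hx, rfl⟩ | ⟨x, hx, rfl⟩) <;> exact ⟨x, hx.1, rfl⟩
    · rintro ⟨x, hx, rfl⟩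
      rcases lt_trichotomy (h x) 0 with h0 | h0 | h0
      · exact Or.inr ⟨x, ⟨hx, h0⟩, rfl⟩
      · exact Or.inl (move x hx h0).1
      · exact Or.inl ⟨x, ⟨hx, h0⟩, rfl⟩

/-- Deletion and restriction. -/
theorem ncard_regions_insert (S : Set (Dual ℝ E)) (hS : S.Finite) (L : Submodule ℝ E)
    (h : Dual ℝ E) (hL : ∃ x ∈ L, h x ≠ 0) :
    (regions (insert h S) L).ncard =
      (regions S L).ncard + (regions S (L ⊓ LinearMap.ker h)).ncard := by
  obtain ⟨hi, hu⟩ := image_posForms_inter S hS L h hL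
  rw [← hi, ← hu, Set.ncard_union_add_ncard_inter _ _ (finite_image_posForms hS _)
    (finite_image_posForms hS _)]
  have h1 : regions (insert h S) L =
      posForms (insert h S) '' {x ∈ genericPoints S L | 0 < h x} ∪
        posForms (insert h S) '' {x ∈ genericPoints S L | h x < 0} := by
    rw [← Set.image_union, regions]
    congr 1
    ext x
    simp only [genericPoints, Set.mem_ofPred_eq, Set.mem_insert_iff, forall_eq_or_imp,
      Set.mem_union]
    constructor
    · rintro ⟨hx, h0, hl⟩
      rcases lt_or_gt_of_ne h0 with h0 | h0
      · exact Or.inr ⟨⟨hx, hl⟩, h0⟩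
      · exact Or.inl ⟨⟨hx, hl⟩, h0⟩
    · rintro (⟨⟨hx, hl⟩, h0⟩ | ⟨⟨hx, hl⟩, h0⟩)
      exacts [⟨hx, h0.ne', hl⟩, ⟨hx, h0.ne, hl⟩]
  rw [h1, Set.ncard_union_eq _ (finite_image_posForms (hS.insert h) _)
    (finite_image_posForms (hS.insert h) _)]
  -- On one side of `h = 0` the sign of `h` is constant, so adding `h` to the forms separates no
  -- further points there.
  · congr 1 <;> refine ncard_image_eq_of_iff fun x hx y hy => ?_ <;>
      simp only [posForms_eq_iff, Set.mem_insert_iff, forall_eq_or_imp, and_iff_right_iff_imp]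
    · exact fun _ => ⟨fun _ => hy.2, fun _ => hx.2⟩
    · exact fun _ => ⟨fun h => absurd hx.2 h.not_gt, fun h => absurd hy.2 h.not_gt⟩
  · rw [Set.disjoint_left]
    rintro _ ⟨x, hx, rfl⟩ ⟨y, hy, hxy⟩
    have := pos_iff_of_posForms_eq hxy (Set.mem_insert h S)
    exact absurd (this.2 hx.2) hy.2.not_gt

/-- Adding to `S` forms which on each other's kernels are proportional to forms of `S`. -/
theorem ncard_regions_union {κ : Type*} (S : Set (Dual ℝ E)) (hS : S.Finite)
    (L : Submodule ℝ E) (h : κ → Dual ℝ E) (T : Finset κ) (hL : ∀ a ∈ T, ∃ x ∈ L, h a x ≠ 0)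
    (hT : ∀ a ∈ T, ∀ b ∈ T, a ≠ b →
      ∃ s ∈ S, ∃ c : ℝ, c ≠ 0 ∧ ∀ x, h a x = 0 → h b x = c * s x) :
    (regions (S ∪ h '' T) L).ncard =
      (regions S L).ncard + ∑ a ∈ T, (regions S (L ⊓ LinearMap.ker (h a))).ncard := by
  classical
  induction T using Finset.induction_on with
  | empty => simp
  | insert a T ha ih =>
    have ih' := ih (fun b hb => hL b (Finset.mem_insert_of_mem hb)) (fun b hb c hc =>
      hT b (Finset.mem_insert_of_mem hb) c (Finset.mem_insert_of_mem hc))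
    have hS' : (S ∪ h '' T).Finite := hS.union (T.finite_toSet.image h)
    rw [Finset.sum_insert ha, Finset.coe_insert, Set.image_insert_eq, Set.union_insert,
      ncard_regions_insert _ hS' _ _ (hL a (Finset.mem_insert_self a T)), ih']
    -- On the kernel of `h a` the other new forms are multiples of forms in `S` and cut nothing.
    suffices hs : (regions (S ∪ h '' T) (L ⊓ LinearMap.ker (h a))).ncard =
        (regions S (L ⊓ LinearMap.ker (h a))).ncard by omega
    have hprop : ∀ b ∈ T, ∃ s ∈ S, ∃ c : ℝ, c ≠ 0 ∧ ∀ x, h a x = 0 → h b x = c * s x :=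
      fun b hb => hT a (Finset.mem_insert_self a T) b (Finset.mem_insert_of_mem hb)
        (by rintro rfl; exact ha hb)
    have hg : genericPoints (S ∪ h '' T) (L ⊓ LinearMap.ker (h a)) =
        genericPoints S (L ⊓ LinearMap.ker (h a)) := by
      ext x
      refine ⟨fun hx => ⟨hx.1, fun l hl => hx.2 l (Or.inl hl)⟩, fun hx => ⟨hx.1, ?_⟩⟩
      rintro l (hl | ⟨b, hb, rfl⟩)
      · exact hx.2 l hl
      · obtain ⟨s, hs, c, hc, hx'⟩ := hprop b hb
        rw [hx' x hx.1.2]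
        exact mul_ne_zero hc (hx.2 s hs)
    rw [regions, regions, hg]
    refine ncard_image_eq_of_iff fun x hx y hy => ?_
    simp only [posForms_eq_iff]
    refine ⟨fun H l hl => H l (Or.inl hl), ?_⟩
    rintro H l (hl | ⟨b, hb, rfl⟩)
    · exact H l hl
    · obtain ⟨s, hs, c, hc, hx'⟩ := hprop b hb
      rw [hx' x hx.1.2, hx' y hy.1.2]
      have h1 := H s hs
      have h2 := hx.2 s hs
      have h3 := hy.2 s hs
      rcases lt_or_gt_of_ne hc with hc | hc
      · rw [mul_pos_iff, mul_pos_iff]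
        simp only [hc.not_gt, hc, false_and, true_and, false_or]
        rw [← not_iff_not, not_lt, not_lt, le_iff_lt_or_eq, le_iff_lt_or_eq]
        simpa [h2.symm, h3.symm] using h1
      · rw [mul_pos_iff_of_pos_left hc, mul_pos_iff_of_pos_left hc, h1]

/-- Forms which factor through a linear map `p` see only the image of `L`. -/
theorem ncard_regions_map {E' : Type*} [AddCommGroup E'] [Module ℝ E'] (p : E →ₗ[ℝ] E')
    (S : Set (Dual ℝ E')) (L : Submodule ℝ E) :
    (regions ((fun l : Dual ℝ E' => l ∘ₗ p) '' S) L).ncard = (regions S (L.map p)).ncard := by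
  have h : regions S (L.map p) =
      (fun x => posForms S (p x)) '' genericPoints ((fun l : Dual ℝ E' => l ∘ₗ p) '' S) L := by
    ext P
    constructor
    · rintro ⟨_, ⟨⟨x, hx, rfl⟩, hl⟩, rfl⟩
      refine ⟨x, ⟨hx, ?_⟩, rfl⟩
      rintro _ ⟨l, h, rfl⟩
      exact hl l h
    · rintro ⟨x, ⟨hx, hl⟩, rfl⟩
      exact ⟨p x, ⟨⟨x, hx, rfl⟩, fun l h => hl _ ⟨l, h, rfl⟩⟩, rfl⟩
  rw [h, regions]
  refine ncard_image_eq_of_iff fun x _ y _ => ?_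
  simp [posForms_eq_iff]

/-- With no forms at all, the zero space would count as one region; this is why the induction on the
dimension starts at 1. -/
theorem regions_bot {S : Set (Dual ℝ E)} (hS : S.Nonempty) :
    regions S (⊥ : Submodule ℝ E) = ∅ := by
  obtain ⟨l, hl⟩ := hS
  rw [regions, Set.image_eq_empty, Set.eq_empty_iff_forall_notMem]
  rintro x ⟨hx, h⟩
  exact h l hl (by rw [(Submodule.mem_bot ℝ).1 hx, map_zero])

end Regions

/-! ### The lattice of the arrangement -/

theorem unit_cases (t : ℤˣ) : ((t : ℤ) : ℝ) = 1 ∨ ((t : ℤ) : ℝ) = -1 := by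
  rcases Int.units_eq_one_or t with rfl | rfl <;> simp

theorem unit_mul_self (t : ℤˣ) : ((t : ℤ) : ℝ) * ((t : ℤ) : ℝ) = 1 := by
  rcases unit_cases t with h | h <;> rw [h] <;> norm_num

theorem unit_ne_zero (t : ℤˣ) : ((t : ℤ) : ℝ) ≠ 0 := by
  rcases unit_cases t with h | h <;> rw [h] <;> norm_num

theorem abs_unit_mul (t : ℤˣ) (x : ℝ) : |((t : ℤ) : ℝ) * x| = |x| := by
  rcases unit_cases t with h | h <;> simp [h]

theorem iInf_mem_arrangementLattice {n : ℕ} {ι : Sort*} {K : ι → Submodule ℝ (Fin n → ℝ)}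
    (h : ∀ i, K i ∈ arrangementLattice n) : ⨅ i, K i ∈ arrangementLattice n := by
  choose S hS hK using h
  refine ⟨⋃ i, S i, Set.iUnion_subset hS, ?_⟩
  simp_rw [hK]
  simp only [sInf_eq_iInf, iInf_iUnion]

theorem top_mem_arrangementLattice (n : ℕ) : ⊤ ∈ arrangementLattice n :=
  ⟨∅, Set.empty_subset _, by simp⟩

theorem inf_mem_arrangementLattice {n : ℕ} {K K' : Submodule ℝ (Fin n → ℝ)}
    (h : K ∈ arrangementLattice n) (h' : K' ∈ arrangementLattice n) :
    K ⊓ K' ∈ arrangementLattice n := by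
  rw [inf_eq_iInf]
  exact iInf_mem_arrangementLattice fun b => by cases b <;> assumption

/-- The hyperplane `x_i = 0`. -/
def coordPlane {n : ℕ} (i : Fin n) : Submodule ℝ (Fin n → ℝ) where
  carrier := {x | x i = 0}
  add_mem' := by intro x y hx hy; simp_all
  zero_mem' := rfl
  smul_mem' := by intro c x hx; simp_all

/-- The hyperplane `x_i = t x_j`. -/
def eqPlane {n : ℕ} (i j : Fin n) (t : ℤˣ) : Submodule ℝ (Fin n → ℝ) where
  carrier := {x | x i = ((t : ℤ) : ℝ) * x j}
  add_mem' := by intro x y hx hy; simp_all [mul_add]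
  zero_mem' := by simp
  smul_mem' := by intro c x hx; simp_all [mul_left_comm]

theorem mem_coordPlane {n : ℕ} {i : Fin n} {x : Fin n → ℝ} : x ∈ coordPlane i ↔ x i = 0 := Iff.rfl

theorem mem_eqPlane {n : ℕ} {i j : Fin n} {t : ℤˣ} {x : Fin n → ℝ} :
    x ∈ eqPlane i j t ↔ x i = ((t : ℤ) : ℝ) * x j := Iff.rfl

theorem mem_lattice_of_mem_arrangement {n : ℕ} {H : Submodule ℝ (Fin n → ℝ)}
    (h : H ∈ reflectionArrangement n) : H ∈ arrangementLattice n :=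
  ⟨{H}, by simpa using h, by simp⟩

theorem coordPlane_eq_ker {n : ℕ} (i : Fin n) : coordPlane i =
    LinearMap.ker (LinearMap.proj (R := ℝ) (φ := fun _ : Fin n => ℝ) i) := by
  ext x; simp [mem_coordPlane]

theorem coordPlane_mem_arrangement {n : ℕ} (i : Fin n) :
    coordPlane i ∈ reflectionArrangement n :=
  Or.inr (Or.inr ⟨i, coordPlane_eq_ker i⟩)

theorem eqPlane_mem_arrangement {n : ℕ} {i j : Fin n} (hij : i < j) (t : ℤˣ) :
    eqPlane i j t ∈ reflectionArrangement n := by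
  rcases Int.units_eq_one_or t with rfl | rfl
  · exact Or.inl ⟨i, j, hij, by ext x; simp [mem_eqPlane, sub_eq_zero]⟩
  · exact Or.inr (Or.inl ⟨i, j, hij, by ext x; simp [mem_eqPlane, add_eq_zero_iff_eq_neg]⟩)

theorem eqPlane_comm {n : ℕ} (i j : Fin n) (t : ℤˣ) : eqPlane i j t = eqPlane j i t := by
  ext x
  rw [mem_eqPlane, mem_eqPlane]
  constructor <;> intro h <;> rw [h, ← mul_assoc, unit_mul_self, one_mul]

theorem coordPlane_mem_lattice {n : ℕ} (i : Fin n) : coordPlane i ∈ arrangementLattice n :=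
  mem_lattice_of_mem_arrangement (coordPlane_mem_arrangement i)

/-- The degenerate case `i = j` is included (whole space or coordinate hyperplane), because pulling
back along `pick` may identify indices. -/
theorem eqPlane_mem_lattice {n : ℕ} (i j : Fin n) (t : ℤˣ) :
    eqPlane i j t ∈ arrangementLattice n := by
  rcases lt_trichotomy i j with h | rfl | h
  · exact mem_lattice_of_mem_arrangement (eqPlane_mem_arrangement h t)
  · rcases Int.units_eq_one_or t with rfl | rfl
    · convert top_mem_arrangementLattice n
      ext x
      simp [mem_eqPlane]
    · convert coordPlane_mem_lattice i
      ext x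
      simp only [mem_eqPlane, mem_coordPlane]
      constructor <;> intro h
      · norm_num at h; linarith
      · simp [h]
  · rw [eqPlane_comm]
    exact mem_lattice_of_mem_arrangement (eqPlane_mem_arrangement h t)

theorem eq_plane_of_mem_arrangement {n : ℕ} {H : Submodule ℝ (Fin n → ℝ)}
    (h : H ∈ reflectionArrangement n) :
    (∃ i j t, i < j ∧ H = eqPlane i j t) ∨ ∃ i, H = coordPlane i := by
  rcases h with ⟨i, j, hij, rfl⟩ | ⟨i, j, hij, rfl⟩ | ⟨i, rfl⟩
  · exact Or.inl ⟨i, j, 1, hij, by ext x; simp [mem_eqPlane, sub_eq_zero]⟩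
  · exact Or.inl ⟨i, j, -1, hij, by ext x; simp [mem_eqPlane, add_eq_zero_iff_eq_neg]⟩
  · exact Or.inr ⟨i, (coordPlane_eq_ker i).symm⟩

/-- The map that picks coordinates with signs. -/
def pick {k n : ℕ} (r : Fin k → Fin n) (s : Fin k → ℤˣ) : (Fin n → ℝ) →ₗ[ℝ] (Fin k → ℝ) :=
  LinearMap.pi fun c => ((s c : ℤ) : ℝ) • LinearMap.proj (r c)

theorem pick_apply {k n : ℕ} (r : Fin k → Fin n) (s : Fin k → ℤˣ) (x : Fin n → ℝ) (c : Fin k) :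
    pick r s x c = ((s c : ℤ) : ℝ) * x (r c) := rfl

theorem comap_pick_mem_lattice {k n : ℕ} (r : Fin k → Fin n) (s : Fin k → ℤˣ)
    {K : Submodule ℝ (Fin k → ℝ)} (hK : K ∈ arrangementLattice k) :
    K.comap (pick r s) ∈ arrangementLattice n := by
  obtain ⟨S, hS, rfl⟩ := hK
  rw [sInf_eq_iInf', Submodule.comap_iInf]
  refine iInf_mem_arrangementLattice fun H => ?_
  rcases eq_plane_of_mem_arrangement (hS H.2) with ⟨i, j, t, -, h⟩ | ⟨i, h⟩
  · convert eqPlane_mem_lattice (r i) (r j) (s i * t * s j) using 1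
    ext x
    rw [Submodule.mem_comap, h, mem_eqPlane, mem_eqPlane, pick_apply, pick_apply]
    push_cast
    constructor
    · intro h
      linear_combination ((s i : ℤ) : ℝ) * h - x (r i) * unit_mul_self (s i)
    · intro h
      linear_combination ((s i : ℤ) : ℝ) * h + ((t : ℤ) : ℝ) * ((s j : ℤ) : ℝ) * x (r j) *
        unit_mul_self (s i)
  · convert coordPlane_mem_lattice (r i) using 1
    ext x
    rw [Submodule.mem_comap, h, mem_coordPlane, mem_coordPlane, pick_apply,
      mul_eq_zero_iff_left (unit_ne_zero _)]

/-- The `o`-th coordinate, which is `0` for `o = ⊤`. -/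
def coordOrZero {k : ℕ} (o : WithTop (Fin k)) : Dual ℝ (Fin k → ℝ) :=
  WithTop.recTopCoe 0 (fun c => LinearMap.proj c) o

@[simp] theorem coordOrZero_top {k : ℕ} (x : Fin k → ℝ) : coordOrZero ⊤ x = 0 := rfl

@[simp] theorem coordOrZero_coe {k : ℕ} (c : Fin k) (x : Fin k → ℝ) :
    coordOrZero (c : WithTop (Fin k)) x = x c := rfl

/-- The parametrization of an element of the lattice: the `i`-th coordinate is `± x_{a(i)}`, or
zero if `a i = ⊤`. -/
def spread {k n : ℕ} (a : Fin n → WithTop (Fin k)) (s : Fin n → ℤˣ) :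
    (Fin k → ℝ) →ₗ[ℝ] (Fin n → ℝ) :=
  LinearMap.pi fun i => ((s i : ℤ) : ℝ) • coordOrZero (a i)

theorem spread_apply {k n : ℕ} (a : Fin n → WithTop (Fin k)) (s : Fin n → ℤˣ) (x : Fin k → ℝ)
    (i : Fin n) : spread a s x i = ((s i : ℤ) : ℝ) * coordOrZero (a i) x := rfl

theorem pick_spread {k n : ℕ} (a : Fin n → WithTop (Fin k)) (s : Fin n → ℤˣ) (r : Fin k → Fin n)
    (hr : ∀ c, a (r c) = c) (x : Fin k → ℝ) : pick r (s ∘ r) (spread a s x) = x := by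
  ext c
  rw [pick_apply, spread_apply, hr, coordOrZero_coe, ← mul_assoc, Function.comp_apply,
    unit_mul_self, one_mul]

theorem spread_injective {k n : ℕ} {a : Fin n → WithTop (Fin k)} (ha : ∀ c : Fin k, ∃ i, a i = c)
    (s : Fin n → ℤˣ) : Function.Injective (spread a s) := by
  choose r hr using ha
  exact Function.LeftInverse.injective (g := pick r (s ∘ r)) (pick_spread a s r hr)

/-- With a representative `r c` chosen in each block, the image is cut out by equations tying every
coordinate to its representative or to zero, together with the condition that the representatives
form a point of `K`. -/
theorem map_spread_mem_lattice {k n : ℕ} {a : Fin n → WithTop (Fin k)}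
    (ha : ∀ c : Fin k, ∃ i, a i = c) (s : Fin n → ℤˣ)
    {K : Submodule ℝ (Fin k → ℝ)} (hK : K ∈ arrangementLattice k) :
    K.map (spread a s) ∈ arrangementLattice n := by
  choose r hr using ha
  have h : K.map (spread a s) = (⨅ i, WithTop.recTopCoe (C := fun _ => Submodule ℝ (Fin n → ℝ))
      (coordPlane i) (fun c => eqPlane i (r c) (s i * s (r c))) (a i)) ⊓
      K.comap (pick r (s ∘ r)) := by
    ext y
    simp only [Submodule.mem_inf, Submodule.mem_iInf, Submodule.mem_comap]
    constructor
    · rintro ⟨x, hx, rfl⟩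
      refine ⟨fun i => ?_, by rwa [pick_spread a s r hr]⟩
      cases h : a i with
      | top => simp [mem_coordPlane, spread_apply, h]
      | coe c =>
        simp only [WithTop.recTopCoe_coe, mem_eqPlane, spread_apply, h, hr, coordOrZero_coe]
        push_cast
        linear_combination -((s i : ℤ) : ℝ) * x c * unit_mul_self (s (r c))
    · rintro ⟨hy, hyK⟩
      refine ⟨_, hyK, ?_⟩
      ext i
      have := hy i
      rw [spread_apply]
      cases h : a i with
      | top => simpa [h, mem_coordPlane, eq_comm] using this
      | coe c =>
        simp only [h, WithTop.recTopCoe_coe, mem_eqPlane] at this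
        rw [coordOrZero_coe, pick_apply, this]
        push_cast
        simp [mul_assoc]
  rw [h]
  refine inf_mem_arrangementLattice (iInf_mem_arrangementLattice fun i => ?_)
    (comap_pick_mem_lattice _ _ hK)
  cases a i with
  | top => exact coordPlane_mem_lattice i
  | coe c => exact eqPlane_mem_lattice _ _ _

/-- `spread` embeds the lattice of `ℝ^k` into that of `ℝ^n` and preserves dimensions, so the
conditions on `L` transfer with the same `d`. -/
theorem InGeneralPosition.comap_spread {k n d : ℕ} {L : Submodule ℝ (Fin n → ℝ)}
    (hL : InGeneralPosition L d) {a : Fin n → WithTop (Fin k)} (ha : ∀ c : Fin k, ∃ i, a i = c)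
    (s : Fin n → ℤˣ) : InGeneralPosition (L.comap (spread a s)) d := by
  intro K hK
  have h := hL _ (map_spread_mem_lattice ha s hK)
  have hinj := spread_injective ha s
  have h1 : finrank ℝ (K.map (spread a s)) = finrank ℝ K :=
    (K.equivMapOfInjective _ hinj).symm.finrank_eq
  have h2 : finrank ℝ ↥(L ⊓ K.map (spread a s)) = finrank ℝ ↥(L.comap (spread a s) ⊓ K) := by
    rw [((L.comap (spread a s) ⊓ K).equivMapOfInjective _ hinj).finrank_eq]
    suffices h : L ⊓ K.map (spread a s) = (L.comap (spread a s) ⊓ K).map (spread a s) by rw [h]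
    refine le_antisymm ?_ ?_
    · rintro _ ⟨hy, x, hx, rfl⟩
      exact ⟨x, ⟨hy, hx⟩, rfl⟩
    · rintro _ ⟨x, ⟨hy, hx⟩, rfl⟩
      exact ⟨hy, x, hx, rfl⟩
  rwa [h1, h2] at h

theorem InGeneralPosition.finrank_eq {k d : ℕ} {L : Submodule ℝ (Fin k → ℝ)}
    (hL : InGeneralPosition L d) : finrank ℝ L = k - d := by
  have h := hL ⊤ (top_mem_arrangementLattice k)
  rw [inf_top_eq L, finrank_top, finrank_fin_fun] at h
  rcases le_total d k with hd | hd
  · have := h.1 hd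
    omega
  · rw [h.2 hd]
    omega

/-- Forget the last coordinate. -/
abbrev dropLast (k : ℕ) : (Fin (k + 1) → ℝ) →ₗ[ℝ] (Fin k → ℝ) := pick Fin.castSucc 1

theorem dropLast_apply {k : ℕ} (x : Fin (k + 1) → ℝ) (c : Fin k) :
    dropLast k x c = x c.castSucc := by simp [pick_apply]

theorem finrank_comap_dropLast {k : ℕ} (K : Submodule ℝ (Fin k → ℝ)) :
    finrank ℝ (K.comap (dropLast k)) = finrank ℝ K + 1 := by
  have hsurj : Function.Surjective (dropLast k) := fun y => ⟨Fin.snoc y 0, by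
    ext c; rw [dropLast_apply, Fin.snoc_castSucc]⟩
  have h1 := (dropLast k).finrank_range_add_finrank_ker
  have h2 := ((dropLast k).domRestrict (K.comap (dropLast k))).finrank_range_add_finrank_ker
  rw [LinearMap.range_eq_top.2 hsurj, finrank_top, finrank_fin_fun, finrank_fin_fun] at h1
  rw [LinearMap.range_domRestrict, Submodule.map_comap_eq_of_surjective hsurj,
    LinearMap.ker_domRestrict] at h2
  have h3 : finrank ℝ ↥((LinearMap.ker (dropLast k)).submoduleOf (K.comap (dropLast k))) =
      finrank ℝ (LinearMap.ker (dropLast k)) :=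
    (Submodule.submoduleOfEquivOfLe (LinearMap.ker_le_comap _)).finrank_eq
  have h4 : (LinearMap.ker (dropLast k)).submoduleOf (K.comap (dropLast k)) =
    (LinearMap.ker (dropLast k)).comap (K.comap (dropLast k)).subtype := rfl
  rw [h4] at h3
  omega

/-- The last coordinate axis is a one-dimensional flat, so `L` meets it trivially and projects
injectively. The preimage of a flat has one dimension more, which turns `d + 1` into `d`. -/
theorem InGeneralPosition.map_dropLast {k d : ℕ} {L : Submodule ℝ (Fin (k + 1) → ℝ)}
    (hL : InGeneralPosition L (d + 1)) : InGeneralPosition (L.map (dropLast k)) d := by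
  have hbot : L ⊓ LinearMap.ker (dropLast k) = ⊥ := by
    have hmem := comap_pick_mem_lattice (Fin.castSucc : Fin k → Fin (k + 1)) 1
      (K := ⨅ i, coordPlane i) (iInf_mem_arrangementLattice fun i => coordPlane_mem_lattice i)
    have h0 : (⨅ i : Fin k, coordPlane i) = ⊥ := by
      rw [eq_bot_iff]
      intro x hx
      rw [Submodule.mem_iInf] at hx
      exact (Submodule.mem_bot ℝ).2 (funext hx)
    have := (hL _ hmem).2
    rw [h0, finrank_comap_dropLast, finrank_bot] at this
    rw [← Submodule.finrank_eq_zero (R := ℝ)]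
    exact this (by omega)
  intro K hK
  have h := hL _ (comap_pick_mem_lattice (Fin.castSucc : Fin k → Fin (k + 1)) 1 hK)
  rw [finrank_comap_dropLast] at h
  have h1 : L.map (dropLast k) ⊓ K = (L ⊓ K.comap (dropLast k)).map (dropLast k) := by
    refine le_antisymm ?_ ?_
    · rintro _ ⟨⟨x, hx, rfl⟩, hy⟩
      exact ⟨x, ⟨hx, hy⟩, rfl⟩
    · rintro _ ⟨x, ⟨hx, hy⟩, rfl⟩
      exact ⟨⟨x, hx, rfl⟩, hy⟩
  have h2 : finrank ℝ ↥(L.map (dropLast k) ⊓ K) = finrank ℝ ↥(L ⊓ K.comap (dropLast k)) := by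
    rw [h1]
    have hinj : Function.Injective ((dropLast k).domRestrict (L ⊓ K.comap (dropLast k))) := by
      rw [← LinearMap.ker_eq_bot, eq_bot_iff]
      rintro ⟨x, hx⟩ hx0
      have : x ∈ L ⊓ LinearMap.ker (dropLast k) := ⟨hx.1, hx0⟩
      rw [hbot] at this
      simpa using this
    rw [← LinearMap.range_domRestrict, LinearMap.finrank_range_of_inj hinj]
  rw [h2]
  push_cast at h ⊢
  exact ⟨fun hd => by rw [h.1 (by omega)]; omega, fun hd => h.2 (by omega)⟩

/-! ### Open chambers and regions -/

/-- The linear forms whose kernels are the hyperplanes of the arrangement. -/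
def forms (k : ℕ) : Set (Dual ℝ (Fin k → ℝ)) :=
  {l | (∃ i, l = LinearMap.proj i) ∨
    ∃ i j, i < j ∧ ∃ t : ℤˣ, l = LinearMap.proj j - ((t : ℤ) : ℝ) • LinearMap.proj i}

theorem proj_mem_forms {k : ℕ} (i : Fin k) :
    (LinearMap.proj i : Dual ℝ (Fin k → ℝ)) ∈ forms k := Or.inl ⟨i, rfl⟩

theorem proj_sub_mem_forms {k : ℕ} {i j : Fin k} (h : i < j) (t : ℤˣ) :
    (LinearMap.proj j - ((t : ℤ) : ℝ) • LinearMap.proj i : Dual ℝ (Fin k → ℝ)) ∈ forms k :=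
  Or.inr ⟨i, j, h, t, rfl⟩

theorem finite_forms (k : ℕ) : (forms k).Finite := by
  refine ((Set.finite_range (fun i : Fin k => (LinearMap.proj i : Dual ℝ (Fin k → ℝ)))).union
    (Set.finite_range (fun p : Fin k × Fin k × ℤˣ =>
      (LinearMap.proj p.2.1 - ((p.2.2 : ℤ) : ℝ) • LinearMap.proj p.1 :
        Dual ℝ (Fin k → ℝ))))).subset ?_
  rintro l (⟨i, rfl⟩ | ⟨i, j, -, t, rfl⟩)
  exacts [Or.inl ⟨i, rfl⟩, Or.inr ⟨(i, j, t), rfl⟩]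

/-- In terms of absolute values, the chamber of a generic point is found by sorting and reading off
signs. -/
theorem forms_ne_zero_iff {k : ℕ} (x : Fin k → ℝ) : (∀ l ∈ forms k, l x ≠ 0) ↔
    (∀ i, x i ≠ 0) ∧ Function.Injective fun i => |x i| := by
  constructor
  · intro h
    refine ⟨fun i => h _ (proj_mem_forms i), ?_⟩
    have : ∀ i j, i < j → |x i| ≠ |x j| := by
      intro i j hij hab
      rcases abs_eq_abs.1 hab with h' | h'
      · exact h _ (proj_sub_mem_forms hij 1) (by simp [h'])
      · exact h _ (proj_sub_mem_forms hij (-1)) (by simp [h'])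
    intro i j hij
    rcases lt_trichotomy i j with h' | h' | h'
    exacts [absurd hij (this i j h'), h', absurd hij.symm (this j i h')]
  · rintro ⟨h0, hinj⟩ l (⟨i, rfl⟩ | ⟨i, j, hij, t, rfl⟩)
    · exact h0 i
    · intro h
      refine hij.ne (hinj ?_)
      have h' : x j = ((t : ℤ) : ℝ) * x i := by simpa [sub_eq_zero] using h
      change |x i| = |x j|
      rw [h', abs_unit_mul]

/-- The interior of the Weyl chamber. -/
def openChamber {k : ℕ} (p : (Fin k → ℤˣ) × Equiv.Perm (Fin k)) : Set (Fin k → ℝ) :=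
  {x | StrictAnti (fun i => ((p.1 i : ℤ) : ℝ) * x (p.2 i)) ∧
    ∀ i, 0 < ((p.1 i : ℤ) : ℝ) * x (p.2 i)}

theorem abs_of_mem_openChamber {k : ℕ} {p : (Fin k → ℤˣ) × Equiv.Perm (Fin k)} {x : Fin k → ℝ}
    (hx : x ∈ openChamber p) (i : Fin k) : |x (p.2 i)| = ((p.1 i : ℤ) : ℝ) * x (p.2 i) := by
  rw [← abs_unit_mul (p.1 i), abs_of_pos (hx.2 i)]

theorem strictAnti_abs_of_mem_openChamber {k : ℕ} {p : (Fin k → ℤˣ) × Equiv.Perm (Fin k)}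
    {x : Fin k → ℝ} (hx : x ∈ openChamber p) : StrictAnti ((fun i => |x i|) ∘ p.2) := by
  convert hx.1 using 2 with i
  exact abs_of_mem_openChamber hx i

theorem forms_ne_zero_of_mem_openChamber {k : ℕ} {p : (Fin k → ℤˣ) × Equiv.Perm (Fin k)}
    {x : Fin k → ℝ} (hx : x ∈ openChamber p) : ∀ l ∈ forms k, l x ≠ 0 := by
  rw [forms_ne_zero_iff]
  refine ⟨fun i => ?_, ?_⟩
  · have := hx.2 (p.2.symm i)
    rw [Equiv.apply_symm_apply] at this
    exact right_ne_zero_of_mul this.ne'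
  · exact ((p.2.injective_comp _).1 (strictAnti_abs_of_mem_openChamber hx).injective)

theorem openChamber_unique {k : ℕ} {p q : (Fin k → ℤˣ) × Equiv.Perm (Fin k)}
    {x : Fin k → ℝ} (hp : x ∈ openChamber p) (hq : x ∈ openChamber q) : p = q := by
  have hx := (forms_ne_zero_iff x).1 (forms_ne_zero_of_mem_openChamber hp)
  have h := Tuple.unique_antitone (strictAnti_abs_of_mem_openChamber hp).antitone
    (strictAnti_abs_of_mem_openChamber hq).antitone
  have h2 : p.2 = q.2 := Equiv.ext fun i => hx.2 (congrFun h i)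
  refine Prod.ext (funext fun i => ?_) h2
  have h3 := abs_of_mem_openChamber hp i
  rw [h2, abs_of_mem_openChamber hq i] at h3
  have h4 := mul_right_cancel₀ (hx.1 _) h3
  exact Units.ext (by exact_mod_cast h4.symm)

theorem exists_mem_openChamber {k : ℕ} {x : Fin k → ℝ} (hx : ∀ l ∈ forms k, l x ≠ 0) :
    ∃ p, x ∈ openChamber p := by
  obtain ⟨h0, hinj⟩ := (forms_ne_zero_iff x).1 hx
  set σ := Tuple.sort fun i => -|x i|
  have hs : StrictMono ((fun i => -|x i|) ∘ σ) :=
    (Tuple.monotone_sort _).strictMono_of_injective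
      ((neg_injective.comp hinj).comp σ.injective)
  set ε : Fin k → ℤˣ := fun i => if 0 < x (σ i) then 1 else -1
  have hε : ∀ i, ((ε i : ℤ) : ℝ) * x (σ i) = |x (σ i)| := by
    intro i
    by_cases h : 0 < x (σ i)
    · simp [ε, h, abs_of_pos h]
    · simp [ε, h, abs_of_nonpos (not_lt.1 h)]
  refine ⟨(ε, σ), fun i j hij => ?_, fun i => ?_⟩
  · simp only [hε]
    simpa using hs hij
  · simp only [hε]
    exact abs_pos.2 (h0 _)

theorem convex_openChamber {k : ℕ} (p : (Fin k → ℤˣ) × Equiv.Perm (Fin k)) {x y : Fin k → ℝ}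
    (hx : x ∈ openChamber p) (hy : y ∈ openChamber p) {a b : ℝ} (ha : 0 < a) (hb : 0 < b) :
    a • x + b • y ∈ openChamber p := by
  have h : ∀ i, ((p.1 i : ℤ) : ℝ) * (a • x + b • y) (p.2 i) =
      a * (((p.1 i : ℤ) : ℝ) * x (p.2 i)) + b * (((p.1 i : ℤ) : ℝ) * y (p.2 i)) := by
    intro i
    simp only [Pi.add_apply, Pi.smul_apply, smul_eq_mul]
    ring
  refine ⟨fun i j hij => ?_, fun i => ?_⟩
  · simp only [h]
    exact add_lt_add (mul_lt_mul_of_pos_left (hx.1 hij) ha) (mul_lt_mul_of_pos_left (hy.1 hij) hb)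
  · rw [h]
    exact add_pos (mul_pos ha (hx.2 i)) (mul_pos hb (hy.2 i))

theorem posForms_eq_of_mem_openChamber {k : ℕ} {p : (Fin k → ℤˣ) × Equiv.Perm (Fin k)}
    {x y : Fin k → ℝ} (hx : x ∈ openChamber p) (hy : y ∈ openChamber p) :
    posForms (forms k) x = posForms (forms k) y := by
  have key : ∀ x y, x ∈ openChamber p → y ∈ openChamber p → ∀ l ∈ forms k, 0 < l x → 0 < l y := by
    intro x y hx hy l hl h
    by_contra hc
    have hneg : l y < 0 :=
      lt_of_le_of_ne (not_lt.1 hc) (forms_ne_zero_of_mem_openChamber hy l hl)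
    -- If `l` changed sign between `x` and `y`, this positive combination would be a zero of `l`
    -- inside the open chamber.
    refine forms_ne_zero_of_mem_openChamber
      (convex_openChamber p hx hy (neg_pos.2 hneg) h) l hl ?_
    simp only [map_add, map_smul, smul_eq_mul]
    ring
  exact posForms_eq_iff.2 fun l hl => ⟨key x y hx hy l hl, key y x hy hx l hl⟩

theorem mem_openChamber_of_posForms_eq {k : ℕ} {p : (Fin k → ℤˣ) × Equiv.Perm (Fin k)}
    {x y : Fin k → ℝ} (hx : x ∈ openChamber p) (hy : ∀ l ∈ forms k, l y ≠ 0)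
    (h : posForms (forms k) x = posForms (forms k) y) : y ∈ openChamber p := by
  have hpos : ∀ l ∈ forms k, ∀ t : ℤˣ, 0 < ((t : ℤ) : ℝ) * l x → 0 < ((t : ℤ) : ℝ) * l y := by
    intro l hl t ht
    have h1 := posForms_eq_iff.1 h l hl
    rcases unit_cases t with h' | h'
    · rw [h', one_mul] at ht ⊢
      exact h1.1 ht
    · rw [h'] at ht ⊢
      have : ¬ 0 < l y := fun h2 => by linarith [h1.2 h2]
      have := lt_of_le_of_ne (not_lt.1 this) (hy l hl)
      linarith
  refine ⟨fun i j hij => ?_, fun i => hpos _ (proj_mem_forms _) _ (hx.2 i)⟩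
  have hlt := hx.1 hij
  simp only at hlt ⊢
  -- The difference of two signed coordinates is plus or minus a form, but `forms` lists only pairs
  -- in increasing order.
  rcases lt_trichotomy (p.2 i) (p.2 j) with h' | h' | h'
  · have := hpos _ (proj_sub_mem_forms h' (p.1 i * p.1 j)) (-p.1 j)
    simp only [LinearMap.sub_apply, LinearMap.proj_apply, LinearMap.smul_apply, smul_eq_mul,
      Units.val_neg, Units.val_mul, Int.cast_neg, Int.cast_mul] at this
    have e : ∀ z : Fin k → ℝ, -((p.1 j : ℤ) : ℝ) *
        (z (p.2 j) - ((p.1 i : ℤ) : ℝ) * ((p.1 j : ℤ) : ℝ) * z (p.2 i)) =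
        ((p.1 i : ℤ) : ℝ) * z (p.2 i) - ((p.1 j : ℤ) : ℝ) * z (p.2 j) := by
      intro z
      linear_combination ((p.1 i : ℤ) : ℝ) * z (p.2 i) * unit_mul_self (p.1 j)
    rw [e, e] at this
    linarith [this (by linarith)]
  · exact absurd (p.2.injective h') hij.ne
  · have := hpos _ (proj_sub_mem_forms h' (p.1 i * p.1 j)) (p.1 i)
    simp only [LinearMap.sub_apply, LinearMap.proj_apply, LinearMap.smul_apply, smul_eq_mul,
      Units.val_mul, Int.cast_mul] at this
    have e : ∀ z : Fin k → ℝ, ((p.1 i : ℤ) : ℝ) *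
        (z (p.2 i) - ((p.1 i : ℤ) : ℝ) * ((p.1 j : ℤ) : ℝ) * z (p.2 j)) =
        ((p.1 i : ℤ) : ℝ) * z (p.2 i) - ((p.1 j : ℤ) : ℝ) * z (p.2 j) := by
      intro z
      linear_combination -((p.1 j : ℤ) : ℝ) * z (p.2 j) * unit_mul_self (p.1 i)
    rw [e, e] at this
    linarith [this (by linarith)]

/-- The chambers whose interior meets `L`. -/
def meetingChambers {k : ℕ} (L : Submodule ℝ (Fin k → ℝ)) :
    Set ((Fin k → ℤˣ) × Equiv.Perm (Fin k)) :=
  {p | ∃ x ∈ L, x ∈ openChamber p}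

theorem ncard_meetingChambers {k : ℕ} (L : Submodule ℝ (Fin k → ℝ)) :
    (meetingChambers L).ncard = (regions (forms k) L).ncard := by
  classical
  let f : (Fin k → ℝ) → (Fin k → ℤˣ) × Equiv.Perm (Fin k) := fun x =>
    -- The default value is never reached: `f` is only used at generic points, all of which lie in a
    -- chamber.
    if h : ∃ p, x ∈ openChamber p then h.choose else 1
  have hf : ∀ p x, x ∈ openChamber p → f x = p := by
    intro p x hx
    have h : ∃ p, x ∈ openChamber p := ⟨p, hx⟩
    simp only [f, dif_pos h]
    exact openChamber_unique h.choose_spec hx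
  have h1 : meetingChambers L = f '' genericPoints (forms k) L := by
    ext p
    constructor
    · rintro ⟨x, hxL, hx⟩
      exact ⟨x, ⟨hxL, forms_ne_zero_of_mem_openChamber hx⟩, hf p x hx⟩
    · rintro ⟨x, ⟨hxL, hx⟩, rfl⟩
      obtain ⟨q, hq⟩ := exists_mem_openChamber hx
      exact ⟨x, hxL, by rwa [hf q x hq]⟩
  rw [h1, regions]
  refine ncard_image_eq_of_iff fun x hx y hy => ?_
  obtain ⟨p, hp⟩ := exists_mem_openChamber hx.2
  obtain ⟨q, hq⟩ := exists_mem_openChamber hy.2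
  rw [hf p x hp, hf q y hq]
  constructor
  · rintro rfl
    exact posForms_eq_of_mem_openChamber hp hq
  · intro h
    exact openChamber_unique (mem_openChamber_of_posForms_eq hp hy.2 h) hq

/-! ### The recursion in the dimension -/

/-- The forms of type `B_{k+1}` which involve the last coordinate. -/
def lastForm {k : ℕ} (o : Option (Fin k × ℤˣ)) : Dual ℝ (Fin (k + 1) → ℝ) :=
  o.elim (LinearMap.proj (Fin.last k)) fun q =>
    LinearMap.proj (Fin.last k) - ((q.2 : ℤ) : ℝ) • LinearMap.proj q.1.castSucc

theorem forms_succ (k : ℕ) : forms (k + 1) =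
    (fun l : Dual ℝ (Fin k → ℝ) => l ∘ₗ dropLast k) '' forms k ∪
      lastForm '' (Finset.univ : Finset (Option (Fin k × ℤˣ))) := by
  ext l
  constructor
  · rintro (⟨i, rfl⟩ | ⟨i, j, hij, t, rfl⟩)
    · cases i using Fin.lastCases with
      | last => exact Or.inr ⟨none, by simp, rfl⟩
      | cast i => exact Or.inl ⟨_, proj_mem_forms i, by ext; simp [dropLast_apply]⟩
    · cases i using Fin.lastCases with
      | last => exact absurd hij (Fin.le_last j).not_gt
      | cast i =>
        cases j using Fin.lastCases with
        | last => exact Or.inr ⟨some (i, t), by simp, rfl⟩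
        | cast j =>
          refine Or.inl ⟨_, proj_sub_mem_forms (Fin.castSucc_lt_castSucc_iff.1 hij) t, ?_⟩
          refine LinearMap.ext fun x => ?_
          simp [dropLast_apply]
  · rintro (⟨l, ⟨i, rfl⟩ | ⟨i, j, hij, t, rfl⟩, rfl⟩ | ⟨o, -, rfl⟩)
    · exact Or.inl ⟨i.castSucc, LinearMap.ext fun x => by simp [dropLast_apply]⟩
    · exact Or.inr ⟨i.castSucc, j.castSucc, Fin.castSucc_lt_castSucc_iff.2 hij, t,
        LinearMap.ext fun x => by simp [dropLast_apply]⟩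
    · cases o with
      | none => exact Or.inl ⟨_, rfl⟩
      | some q => exact Or.inr ⟨q.1.castSucc, Fin.last k, Fin.castSucc_lt_last _, q.2, rfl⟩

/-- Substituting the equation of one hyperplane into the form of another eliminates the last
coordinate; what remains is a nonzero multiple of a form of type `B_k`. -/
theorem lastForm_proportional {k : ℕ} {o o' : Option (Fin k × ℤˣ)} (h : o ≠ o') :
    ∃ s ∈ (fun l : Dual ℝ (Fin k → ℝ) => l ∘ₗ dropLast k) '' forms k, ∃ c : ℝ, c ≠ 0 ∧
      ∀ x, lastForm o x = 0 → lastForm o' x = c * s x := by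
  have e1 : ∀ x : Fin (k + 1) → ℝ, lastForm none x = x (Fin.last k) := fun _ => rfl
  have e2 : ∀ (i : Fin k) t (x : Fin (k + 1) → ℝ), lastForm (some (i, t)) x =
    x (Fin.last k) - ((t : ℤ) : ℝ) * x i.castSucc := fun _ _ _ => rfl
  rcases o with _ | ⟨i, t⟩ <;> rcases o' with _ | ⟨j, u⟩
  · exact absurd rfl h
  · refine ⟨_, ⟨_, proj_mem_forms j, rfl⟩, -((u : ℤ) : ℝ), neg_ne_zero.2 (unit_ne_zero u),
      fun x hx => ?_⟩
    rw [e1] at hx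
    rw [e2, hx]
    simp [dropLast_apply]
  · refine ⟨_, ⟨_, proj_mem_forms i, rfl⟩, ((t : ℤ) : ℝ), unit_ne_zero t, fun x hx => ?_⟩
    rw [e2, sub_eq_zero] at hx
    rw [e1, hx]
    simp [dropLast_apply]
  · rcases lt_trichotomy i j with hij | rfl | hij
    · refine ⟨_, ⟨_, proj_sub_mem_forms hij (t * u), rfl⟩, -((u : ℤ) : ℝ),
        neg_ne_zero.2 (unit_ne_zero u), fun x hx => ?_⟩
      rw [e2, sub_eq_zero] at hx
      rw [e2, hx]
      simp only [LinearMap.comp_apply, LinearMap.sub_apply, LinearMap.smul_apply,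
        LinearMap.proj_apply, dropLast_apply, Units.val_mul, Int.cast_mul, smul_eq_mul]
      linear_combination -((t : ℤ) : ℝ) * x i.castSucc * unit_mul_self u
    · have htu : t ≠ u := by rintro rfl; exact h rfl
      refine ⟨_, ⟨_, proj_mem_forms i, rfl⟩, ((t : ℤ) : ℝ) - ((u : ℤ) : ℝ), ?_, fun x hx => ?_⟩
      · rw [sub_ne_zero]
        intro h
        exact htu (Units.ext (by exact_mod_cast h))
      · rw [e2, sub_eq_zero] at hx
        rw [e2, hx]
        simp only [LinearMap.comp_apply, LinearMap.proj_apply, dropLast_apply]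
        ring
    · refine ⟨_, ⟨_, proj_sub_mem_forms hij (t * u), rfl⟩, ((t : ℤ) : ℝ),
        unit_ne_zero t, fun x hx => ?_⟩
      rw [e2, sub_eq_zero] at hx
      rw [e2, hx]
      simp only [LinearMap.comp_apply, LinearMap.sub_apply, LinearMap.smul_apply,
        LinearMap.proj_apply, dropLast_apply, Units.val_mul, Int.cast_mul, smul_eq_mul]
      linear_combination ((u : ℤ) : ℝ) * x j.castSucc * unit_mul_self t

/-- The index map of the parametrization of the kernel of `lastForm o`. -/
def lastIndex {k : ℕ} (o : Option (Fin k × ℤˣ)) : Fin (k + 1) → WithTop (Fin k) :=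
  Fin.snoc (α := fun _ => WithTop (Fin k)) (fun c => (c : WithTop (Fin k)))
    (o.elim ⊤ fun q => (q.1 : WithTop (Fin k)))

/-- The signs of the parametrization of the kernel of `lastForm o`. -/
def lastSign {k : ℕ} (o : Option (Fin k × ℤˣ)) : Fin (k + 1) → ℤˣ :=
  Fin.snoc (α := fun _ => ℤˣ) (fun _ => 1) (o.elim 1 fun q => q.2)

theorem lastIndex_castSucc {k : ℕ} (o : Option (Fin k × ℤˣ)) (c : Fin k) :
    lastIndex o c.castSucc = c := by simp [lastIndex]

theorem spread_last {k : ℕ} (o : Option (Fin k × ℤˣ)) (y : Fin k → ℝ) :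
    dropLast k (spread (lastIndex o) (lastSign o) y) = y ∧
      lastForm o (spread (lastIndex o) (lastSign o) y) = 0 := by
  have h1 : ∀ c : Fin k, spread (lastIndex o) (lastSign o) y c.castSucc = y c := by
    intro c
    simp [spread_apply, lastIndex, lastSign]
  refine ⟨funext fun c => by rw [dropLast_apply, h1], ?_⟩
  cases o with
  | none => simp [lastForm, spread_apply, lastIndex]
  | some q =>
    simp only [lastForm, Option.elim, LinearMap.sub_apply, LinearMap.smul_apply,
      LinearMap.proj_apply, h1, smul_eq_mul]
    simp [spread_apply, lastIndex, lastSign]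

theorem eq_of_dropLast_eq {k : ℕ} (o : Option (Fin k × ℤˣ)) {x y : Fin (k + 1) → ℝ}
    (hx : lastForm o x = 0) (hy : lastForm o y = 0) (h : dropLast k x = dropLast k y) : x = y := by
  have h1 : ∀ c : Fin k, x c.castSucc = y c.castSucc := fun c => by
    simpa [dropLast_apply] using congrFun h c
  ext i
  cases i using Fin.lastCases with
  | cast c => exact h1 c
  | last =>
    cases o with
    | none => exact hx.trans hy.symm
    | some q =>
      simp only [lastForm, Option.elim, LinearMap.sub_apply, LinearMap.smul_apply,
        LinearMap.proj_apply, smul_eq_mul, sub_eq_zero] at hx hy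
      rw [hx, hy, h1]

/-- On the kernel of `lastForm o`, dropping the last coordinate is inverse to the parametrization by
`spread`. -/
theorem map_dropLast_inf_ker {k : ℕ} (o : Option (Fin k × ℤˣ))
    (L : Submodule ℝ (Fin (k + 1) → ℝ)) :
    (L ⊓ LinearMap.ker (lastForm o)).map (dropLast k) =
      L.comap (spread (lastIndex o) (lastSign o)) := by
  ext y
  constructor
  · rintro ⟨x, ⟨hx, hx0⟩, rfl⟩
    rw [Submodule.mem_comap]
    have := spread_last o (dropLast k x)
    rwa [eq_of_dropLast_eq o this.2 hx0 this.1]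
  · intro hy
    exact ⟨_, ⟨hy, (spread_last o y).2⟩, (spread_last o y).1⟩

theorem ncard_meetingChambers_succ {k d : ℕ} (hk : 1 ≤ k) {L : Submodule ℝ (Fin (k + 1) → ℝ)}
    (hL : InGeneralPosition L d) :
    (meetingChambers L).ncard = (meetingChambers (L.map (dropLast k))).ncard +
      ∑ o : Option (Fin k × ℤˣ),
        (meetingChambers (L.comap (spread (lastIndex o) (lastSign o)))).ncard := by
  have hcomap : ∀ o : Option (Fin k × ℤˣ),
      InGeneralPosition (L.comap (spread (lastIndex o) (lastSign o))) d := fun o =>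
    hL.comap_spread (fun c => ⟨c.castSucc, lastIndex_castSucc o c⟩) _
  simp only [ncard_meetingChambers]
  -- For `d > k` all subspaces involved are zero and, as `1 ≤ k`, all counts vanish.
  rcases Nat.lt_or_ge k d with hd | hd
  · have hne : ∀ m, 1 ≤ m → (forms m).Nonempty := fun m hm => ⟨_, proj_mem_forms ⟨0, hm⟩⟩
    have hbot : L = ⊥ := by
      rw [← Submodule.finrank_eq_zero (R := ℝ), hL.finrank_eq]
      omega
    have hbot' : ∀ o : Option (Fin k × ℤˣ), L.comap (spread (lastIndex o) (lastSign o)) = ⊥ := by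
      intro o
      rw [← Submodule.finrank_eq_zero (R := ℝ), (hcomap o).finrank_eq]
      omega
    simp only [hbot']
    simp [hbot, regions_bot (hne k hk), regions_bot (hne (k + 1) (by omega))]
  · rw [forms_succ, ncard_regions_union _ ((finite_forms k).image _) L lastForm Finset.univ]
    · rw [ncard_regions_map]
      congr 1
      refine Finset.sum_congr rfl fun o _ => ?_
      rw [ncard_regions_map, map_dropLast_inf_ker]
    · intro o _
      -- If the form vanished on `L`, then `L` would be isomorphic to its preimage under `spread`,
      -- whose dimension is `k - d` instead of `k + 1 - d`.
      by_contra! hc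
      have h1 : L ⊓ LinearMap.ker (lastForm o) = L := inf_eq_left.2 fun x hx => hc x hx
      have h2 := map_dropLast_inf_ker o L
      rw [h1] at h2
      have h3 := (hcomap o).finrank_eq
      rw [← h2] at h3
      have h4 : finrank ℝ (L.map (dropLast k)) = finrank ℝ L := by
        rw [← LinearMap.range_domRestrict, LinearMap.finrank_range_of_inj]
        rintro ⟨x, hx⟩ ⟨y, hy⟩ hxy
        exact Subtype.ext (eq_of_dropLast_eq o (hc x hx) (hc y hy) hxy)
      rw [h4, hL.finrank_eq] at h3
      omega
    · intro o _ o' _ h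
      exact lastForm_proportional h

/-! ### The numbers `B(k, j)` -/

theorem B_of_neg {k : ℕ} {j : ℤ} (h : j < 0) : B k j = 0 := if_neg (not_le.2 h)

theorem B_zero (j : ℤ) : B 0 j = if j = 0 then 1 else 0 := by
  rcases lt_trichotomy j 0 with h | rfl | h
  · rw [B_of_neg h, if_neg h.ne]
  · simp [B]
  · rw [B, if_pos h.le, if_neg h.ne', Finset.range_zero, Finset.prod_empty,
      Polynomial.coeff_one, if_neg (by omega)]

theorem B_succ (k : ℕ) (j : ℤ) : B (k + 1) j = B k (j - 1) + (2 * k + 1) * B k j := by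
  rcases lt_trichotomy j 0 with h | rfl | h
  · rw [B_of_neg h, B_of_neg h, B_of_neg (by omega)]
    rfl
  · rw [B_of_neg (by omega : (0 : ℤ) - 1 < 0)]
    simp only [B, le_refl, if_true, Finset.prod_range_succ, Int.toNat_zero, mul_add,
      Polynomial.coeff_add, Polynomial.coeff_mul_X_zero]
    rw [Polynomial.coeff_mul_C, mul_comm]
  · obtain ⟨m, rfl⟩ : ∃ m : ℕ, j = m + 1 := ⟨(j - 1).toNat, by omega⟩
    have e : ((m : ℤ) + 1).toNat = m + 1 := by omega
    rw [add_sub_cancel_right]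
    simp only [B, h.le, if_true, Int.natCast_nonneg, e, Int.toNat_natCast]
    rw [Finset.prod_range_succ, mul_add, Polynomial.coeff_add, Polynomial.coeff_mul_X,
      Polynomial.coeff_mul_C, mul_comm (2 * k + 1)]

/-- `B(k, d-1) + B(k, d-3) + ⋯`. -/
def alternateSum (k d : ℕ) : ℕ := ∑ r ∈ Finset.range d, B k ((d : ℤ) - 1 - 2 * (r : ℤ))

theorem alternateSum_zero_right (k : ℕ) : alternateSum k 0 = 0 := rfl

theorem alternateSum_add_two (k d : ℕ) :
    alternateSum k (d + 2) = alternateSum k d + B k (d + 1) := by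
  rw [alternateSum, Finset.sum_range_succ', Finset.sum_range_succ, alternateSum,
    B_of_neg (by push_cast; omega), add_zero]
  congr 1
  · refine Finset.sum_congr rfl fun r _ => ?_
    congr 1
    push_cast
    ring
  · congr 1
    push_cast
    ring

/-- Exactly one of `d`, `d + 1` is odd, and only an odd argument reaches the single nonzero number
`B(0, 0)`. -/
theorem alternateSum_zero_left (d : ℕ) : alternateSum 0 d + alternateSum 0 (d + 1) = 1 := by
  induction d with
  | zero => simp [alternateSum, B_zero]
  | succ d ih =>
    rw [alternateSum_add_two, B_zero, if_neg (by omega)]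
    omega

theorem alternateSum_succ_succ (k d : ℕ) : alternateSum (k + 1) (d + 1) =
    alternateSum k d + (2 * k + 1) * alternateSum k (d + 1) := by
  simp only [alternateSum, B_succ, Finset.sum_add_distrib, ← Finset.mul_sum]
  rw [Finset.sum_range_succ, B_of_neg (by push_cast; omega), add_zero]
  congr 1
  refine Finset.sum_congr rfl fun r _ => ?_
  congr 1
  push_cast
  ring

/-! ### Counting the chambers which meet `L` trivially -/

theorem card_chambers (k : ℕ) :
    Nat.card ((Fin k → ℤˣ) × Equiv.Perm (Fin k)) = 2 ^ k * k.factorial := by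
  simp [Fintype.card_perm]

theorem meetingChambers_top (k : ℕ) :
    meetingChambers (⊤ : Submodule ℝ (Fin k → ℝ)) = Set.univ := by
  rw [Set.eq_univ_iff_forall]
  rintro ⟨ε, σ⟩
  -- The signed coordinates of this point are `k, k - 1, …, 1`.
  refine ⟨fun i => ((ε (σ.symm i) : ℤ) : ℝ) * ((k : ℝ) - (σ.symm i : ℕ)), trivial, ?_⟩
  have h : ∀ i, ((ε i : ℤ) : ℝ) * (((ε (σ.symm (σ i)) : ℤ) : ℝ) *
      ((k : ℝ) - (σ.symm (σ i) : ℕ))) = (k : ℝ) - (i : ℕ) := by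
    intro i
    rw [Equiv.symm_apply_apply, ← mul_assoc, unit_mul_self, one_mul]
  refine ⟨fun i j hij => ?_, fun i => ?_⟩
  · simp only [h]
    have : ((i : ℕ) : ℝ) < ((j : ℕ) : ℝ) := by exact_mod_cast hij
    linarith
  · simp only [h]
    have : ((i : ℕ) : ℝ) < (k : ℝ) := by exact_mod_cast i.2
    linarith

theorem InGeneralPosition.eq_top {k : ℕ} {L : Submodule ℝ (Fin k → ℝ)}
    (hL : InGeneralPosition L 0) : L = ⊤ :=
  Submodule.eq_top_of_finrank_eq (by rw [hL.finrank_eq]; simp)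

theorem ncard_meetingChambers_add {k d : ℕ} (hk : 1 ≤ k) {L : Submodule ℝ (Fin k → ℝ)}
    (hL : InGeneralPosition L d) :
    (meetingChambers L).ncard + 2 * alternateSum k d = 2 ^ k * k.factorial := by
  rcases Nat.eq_zero_or_pos d with rfl | hd
  · rw [hL.eq_top, meetingChambers_top, Set.ncard_univ, card_chambers, alternateSum_zero_right,
      mul_zero, add_zero]
  obtain ⟨d, rfl⟩ : ∃ e, d = e + 1 := ⟨d - 1, by omega⟩
  clear hd
  induction k, hk using Nat.le_induction generalizing d with
  | base =>
    have hbot : L = ⊥ := by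
      rw [← Submodule.finrank_eq_zero (R := ℝ), hL.finrank_eq]
      omega
    rw [ncard_meetingChambers, hbot, regions_bot ⟨_, proj_mem_forms 0⟩,
      alternateSum_succ_succ 0 d]
    have := alternateSum_zero_left d
    simp
    omega
  | succ k hk ih =>
    rw [ncard_meetingChambers_succ hk hL, alternateSum_succ_succ]
    have h1 : (meetingChambers (L.map (dropLast k))).ncard + 2 * alternateSum k d =
        2 ^ k * k.factorial := by
      have h := hL.map_dropLast
      cases d with
      | zero =>
        rw [h.eq_top, meetingChambers_top, Set.ncard_univ, card_chambers,
          alternateSum_zero_right, mul_zero, add_zero]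
      | succ d => exact ih d h
    have h2 : ∀ o : Option (Fin k × ℤˣ),
        (meetingChambers (L.comap (spread (lastIndex o) (lastSign o)))).ncard =
          2 ^ k * k.factorial - 2 * alternateSum k (d + 1) := fun o => by
      have := ih d (hL.comap_spread (fun c => ⟨c.castSucc, lastIndex_castSucc o c⟩)
        (lastSign o))
      omega
    -- This bound makes the truncated subtraction in `h2` exact.
    have h3 : 2 * alternateSum k (d + 1) ≤ 2 ^ k * k.factorial := by
      have := ih d (hL.comap_spread (fun c => ⟨c.castSucc, lastIndex_castSucc none c⟩)
        (lastSign none))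
      omega
    simp only [h2]
    obtain ⟨m, hm⟩ := Nat.exists_eq_add_of_le h3
    have hc : Fintype.card (Option (Fin k × ℤˣ)) = 2 * k + 1 := by simp [mul_comm]
    rw [Finset.sum_const, Finset.card_univ, hc, hm, Nat.add_sub_cancel_left, smul_eq_mul,
      pow_succ, Nat.factorial_succ]
    rw [hm] at h1
    have : 2 ^ k * 2 * ((k + 1) * k.factorial) = 2 * (k + 1) * (2 ^ k * k.factorial) := by ring
    rw [this, hm]
    linarith

theorem mem_chamber_iff {k : ℕ} {ε : Fin k → ℤˣ} {σ : Equiv.Perm (Fin k)} {x : Fin k → ℝ} :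
    x ∈ chamber ε σ ↔ (Antitone fun i => ((ε i : ℤ) : ℝ) * x (σ i)) ∧
      ∀ i, 0 ≤ ((ε i : ℤ) : ℝ) * x (σ i) := Iff.rfl

/-- A subspace in general position which meets a closed chamber nontrivially also meets its
interior. -/
theorem InGeneralPosition.exists_mem_openChamber {k d : ℕ} {L : Submodule ℝ (Fin k → ℝ)}
    (hL : InGeneralPosition L d) {p : (Fin k → ℤˣ) × Equiv.Perm (Fin k)} {x : Fin k → ℝ}
    (hxL : x ∈ L) (hx : x ∈ chamber p.1 p.2) (hx0 : x ≠ 0) : p ∈ meetingChambers L := by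
  -- The smallest flat containing `x`. As `L ⊓ K` is nonzero, general position forces `d < dim K`,
  -- and then `L ⊔ K` is everything.
  set K : Submodule ℝ (Fin k → ℝ) := sInf {H ∈ reflectionArrangement k | x ∈ H} with hKdef
  have hK : K ∈ arrangementLattice k := ⟨_, Set.sep_subset _ _, rfl⟩
  have hxK : x ∈ K := (Submodule.mem_sInf).2 fun H hH => hH.2
  have hpos : 0 < finrank ℝ ↥(L ⊓ K) :=
    Module.finrank_pos_iff_exists_ne_zero.2
      ⟨⟨x, hxL, hxK⟩, fun h => hx0 (congrArg Subtype.val h)⟩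
  have hdK : d < finrank ℝ K := by
    by_contra hc
    have := (hL K hK).2 (not_lt.1 hc)
    omega
  have hsup : L ⊔ K = ⊤ := by
    apply Submodule.eq_top_of_finrank_eq
    have h1 := Submodule.finrank_sup_add_finrank_inf_eq L K
    have h2 := (hL K hK).1 hdK.le
    have h3 := hL.finrank_eq
    have h4 := Submodule.finrank_le K
    rw [finrank_fin_fun] at h4 ⊢
    omega
  obtain ⟨y, -, hy⟩ : p ∈ meetingChambers ⊤ := by rw [meetingChambers_top]; trivial
  obtain ⟨l, hl, κ, hκ, rfl⟩ := Submodule.mem_sup.1 (hsup ▸ Submodule.mem_top : y ∈ L ⊔ K)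
  rw [Submodule.mem_sInf] at hκ
  -- Move from `x` along the `L`-part `l` of an interior point `l + κ`. A defining form that
  -- vanishes at `x` also vanishes at `κ`, hence is positive at `l`; one that is positive at `x`
  -- stays so for small steps.
  have key : ∀ f : Dual ℝ (Fin k → ℝ), (f x = 0 → f κ = 0) → 0 ≤ f x → 0 < f (l + κ) →
      ∀ᶠ c : ℝ in nhdsWithin 0 (Set.Ioi 0), 0 < f (x + c • l) := by
    intro f h1 h2 h3
    rcases h2.eq_or_lt with h0 | h0
    · filter_upwards [self_mem_nhdsWithin] with c hc
      rw [map_add, h1 h0.symm, add_zero] at h3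
      rw [map_add, ← h0, zero_add, map_smul]
      exact mul_pos hc h3
    · have ht : Filter.Tendsto (fun c : ℝ => f x + c * f l) (nhdsWithin 0 (Set.Ioi 0))
          (nhds (f x + 0 * f l)) :=
        (Continuous.tendsto (by fun_prop) 0).mono_left nhdsWithin_le_nhds
      rw [zero_mul, add_zero] at ht
      filter_upwards [ht.eventually (lt_mem_nhds h0)] with c hc
      simpa using hc
  have hev1 : ∀ i, ∀ᶠ c : ℝ in nhdsWithin 0 (Set.Ioi 0),
      0 < ((p.1 i : ℤ) : ℝ) * (x + c • l) (p.2 i) := by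
    intro i
    refine key (((p.1 i : ℤ) : ℝ) • LinearMap.proj (p.2 i)) (fun h => ?_) (hx.2 i) (hy.2 i)
    have h' : x (p.2 i) = 0 := by simpa [unit_ne_zero] using h
    have := hκ _ ⟨coordPlane_mem_arrangement (p.2 i), h'⟩
    rw [mem_coordPlane] at this
    simp [this]
  have hev2 : ∀ i j, i < j → ∀ᶠ c : ℝ in nhdsWithin 0 (Set.Ioi 0),
      ((p.1 j : ℤ) : ℝ) * (x + c • l) (p.2 j) < ((p.1 i : ℤ) : ℝ) * (x + c • l) (p.2 i) := by
    intro i j hij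
    have hplane : ∀ z : Fin k → ℝ, ((p.1 i : ℤ) : ℝ) * z (p.2 i) = ((p.1 j : ℤ) : ℝ) * z (p.2 j) ↔
        z ∈ eqPlane (p.2 i) (p.2 j) (p.1 i * p.1 j) := by
      intro z
      rw [mem_eqPlane]
      push_cast
      constructor
      · intro h
        linear_combination ((p.1 i : ℤ) : ℝ) * h - z (p.2 i) * unit_mul_self (p.1 i)
      · intro h
        linear_combination ((p.1 i : ℤ) : ℝ) * h + ((p.1 j : ℤ) : ℝ) * z (p.2 j) *
          unit_mul_self (p.1 i)
    have harr : eqPlane (p.2 i) (p.2 j) (p.1 i * p.1 j) ∈ reflectionArrangement k := by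
      rcases lt_or_gt_of_ne (p.2.injective.ne hij.ne) with h | h
      · exact eqPlane_mem_arrangement h _
      · rw [eqPlane_comm]
        exact eqPlane_mem_arrangement h _
    have := key (((p.1 i : ℤ) : ℝ) • LinearMap.proj (p.2 i) -
      ((p.1 j : ℤ) : ℝ) • LinearMap.proj (p.2 j)) (fun h => ?_) ?_ ?_
    · filter_upwards [this] with c hc
      exact sub_pos.1 hc
    · have h' := hκ _ ⟨harr, (hplane x).1 (sub_eq_zero.1 h)⟩
      exact sub_eq_zero.2 ((hplane κ).2 h')
    · exact sub_nonneg.2 (hx.1 i j hij.le)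
    · exact sub_pos.2 (hy.1 hij)
  have hev : ∀ᶠ c : ℝ in nhdsWithin 0 (Set.Ioi 0), x + c • l ∈ openChamber p := by
    have h2 : ∀ᶠ c : ℝ in nhdsWithin 0 (Set.Ioi 0), ∀ i j, i < j →
        ((p.1 j : ℤ) : ℝ) * (x + c • l) (p.2 j) < ((p.1 i : ℤ) : ℝ) * (x + c • l) (p.2 i) := by
      simp only [Filter.eventually_all]
      exact hev2
    filter_upwards [Filter.eventually_all.2 hev1, h2] with c hc1 hc2
    exact ⟨fun i j hij => hc2 i j hij, hc1⟩
  obtain ⟨c, hc⟩ := hev.exists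
  exact ⟨_, L.add_mem hxL (L.smul_mem c hl), hc⟩

/-- The number of closed chambers which meet `L` only at the origin. -/
theorem ncard_trivial_chambers {k d : ℕ} (hk : 1 ≤ k) {L : Submodule ℝ (Fin k → ℝ)}
    (hL : InGeneralPosition L d) :
    {p : (Fin k → ℤˣ) × Equiv.Perm (Fin k) | ∀ x ∈ L, x ∈ chamber p.1 p.2 → x = 0}.ncard =
      2 * alternateSum k d := by
  have h : {p : (Fin k → ℤˣ) × Equiv.Perm (Fin k) | ∀ x ∈ L, x ∈ chamber p.1 p.2 → x = 0} =
      (meetingChambers L)ᶜ := by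
    ext p
    constructor
    · rintro hp ⟨x, hxL, hx⟩
      have h0 := hp x hxL ⟨fun i j hij => hx.1.antitone hij, fun i => (hx.2 i).le⟩
      have := hx.2 ⟨0, hk⟩
      simp [h0] at this
    · intro hp x hxL hx
      by_contra hx0
      exact hp (hL.exists_mem_openChamber hxL hx hx0)
  have h1 := Set.ncard_add_ncard_compl (meetingChambers L)
  have h2 := ncard_meetingChambers_add hk hL
  rw [card_chambers] at h1
  rw [h]
  omega

/-! ### Faces of simplicial cones -/

section SimplicialCone

variable {n : ℕ} {ι : Type*} (f : ι → Dual ℝ (Fin n → ℝ))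

/-- The face of the cone `{x | ∀ i, 0 ≤ f i x}` on which `f i` vanishes for `i ∉ I`. -/
def coneFace (I : Finset ι) : PointedCone ℝ (Fin n → ℝ) where
  carrier := {x | (∀ i, 0 ≤ f i x) ∧ ∀ i ∉ I, f i x = 0}
  add_mem' := by
    rintro x y ⟨hx, hx'⟩ ⟨hy, hy'⟩
    refine ⟨fun i => ?_, fun i hi => ?_⟩
    · rw [map_add]
      exact add_nonneg (hx i) (hy i)
    · rw [map_add, hx' i hi, hy' i hi, add_zero]
  zero_mem' := by simp
  smul_mem' := by
    rintro ⟨c, hc⟩ x ⟨hx, hx'⟩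
    refine ⟨fun i => ?_, fun i hi => ?_⟩
    · change 0 ≤ f i (c • x)
      rw [map_smul]
      exact mul_nonneg hc (hx i)
    · change f i (c • x) = 0
      rw [map_smul, hx' i hi, smul_zero]

theorem mem_coneFace {I : Finset ι} {x : Fin n → ℝ} :
    x ∈ coneFace f I ↔ (∀ i, 0 ≤ f i x) ∧ ∀ i ∉ I, f i x = 0 := Iff.rfl

/-- A face is determined by the set `I` of forms that are positive somewhere on it. The sum `z` of
witnesses is positive for all of `I` at once, so for `y` in `coneFace f I` and small `c > 0` the
point `z - c y` stays in `Q`, and the face property puts `y` into the face. -/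
theorem isFaceOf_iff_exists_coneFace [Finite ι] {Q : PointedCone ℝ (Fin n → ℝ)}
    (hQ : ∀ x, x ∈ Q ↔ ∀ i, 0 ≤ f i x) {F : PointedCone ℝ (Fin n → ℝ)} :
    F.IsFaceOf Q ↔ ∃ I, F = coneFace f I := by
  classical
  cases nonempty_fintype ι
  constructor
  · intro hF
    refine ⟨Finset.univ.filter fun i => ∃ x ∈ F, 0 < f i x, le_antisymm ?_ ?_⟩
    · intro x hx
      have hxQ := (hQ x).1 (hF.le hx)
      refine ⟨hxQ, fun i hi => ?_⟩
      by_contra hne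
      exact hi (Finset.mem_filter.2
        ⟨Finset.mem_univ i, x, hx, lt_of_le_of_ne (hxQ i) (Ne.symm hne)⟩)
    · rintro y ⟨hy, hy'⟩
      have hch : ∀ i, ∃ x ∈ F, f i y ≠ 0 → 0 < f i x := by
        intro i
        by_cases hi : f i y = 0
        · exact ⟨0, F.zero_mem, fun h => absurd hi h⟩
        · have hmem := not_imp_comm.1 (hy' i) hi
          obtain ⟨x, hx, hpos⟩ := (Finset.mem_filter.1 hmem).2
          exact ⟨x, hx, fun _ => hpos⟩
      choose x hx hpos using hch
      have hzF : ∑ i, x i ∈ F := Submodule.sum_mem _ fun i _ => hx i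
      have hz : ∀ i, f i (x i) ≤ f i (∑ j, x j) := by
        intro i
        rw [map_sum]
        exact Finset.single_le_sum (f := fun j => f i (x j))
          (fun j _ => (hQ _).1 (hF.le (hx j)) i) (Finset.mem_univ i)
      have hev : ∀ᶠ c : ℝ in nhdsWithin 0 (Set.Ioi 0), ∀ i, 0 ≤ f i (∑ j, x j) - c * f i y := by
        rw [Filter.eventually_all]
        intro i
        by_cases hi : f i y = 0
        · simp only [hi, mul_zero, sub_zero]
          exact Filter.Eventually.of_forall fun _ => (hQ _).1 (hF.le hzF) i
        · have h0 : 0 < f i (∑ j, x j) := lt_of_lt_of_le (hpos i hi) (hz i)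
          have ht : Filter.Tendsto (fun c : ℝ => f i (∑ j, x j) - c * f i y)
              (nhdsWithin 0 (Set.Ioi 0)) (nhds (f i (∑ j, x j) - 0 * f i y)) :=
            (Continuous.tendsto (by fun_prop) 0).mono_left nhdsWithin_le_nhds
          rw [zero_mul, sub_zero] at ht
          filter_upwards [ht.eventually (lt_mem_nhds h0)] with c hc using hc.le
      obtain ⟨c, hc, hc0⟩ := (hev.and self_mem_nhdsWithin).exists
      have hc0' : (0 : ℝ) < c := hc0
      refine hF.mem_of_smul_add_mem (y := ∑ j, x j - c • y) ((hQ y).2 hy) ?_ hc0' ?_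
      · rw [hQ]
        intro i
        simpa using hc i
      · simpa using hzF
  · rintro ⟨I, rfl⟩
    refine ⟨fun x hx => (hQ x).2 hx.1, ?_⟩
    intro x y a hx hy ha hxy
    rw [hQ] at hx hy
    refine ⟨hx, fun i hi => ?_⟩
    have h := hxy.2 i hi
    rw [map_add, map_smul, smul_eq_mul] at h
    have h1 := hx i
    have h2 := mul_nonneg ha.le h1
    have h3 := hy i
    have h4 : a * f i x = 0 := by linarith
    exact (mul_eq_zero.1 h4).resolve_left ha.ne'

variable [DecidableEq ι] {f} {v : ι → Fin n → ℝ}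

theorem mem_coneFace_of_dual (hv : ∀ i j, f i (v j) = if i = j then 1 else 0) {I : Finset ι}
    {j : ι} : v j ∈ coneFace f I ↔ j ∈ I := by
  rw [mem_coneFace]
  constructor
  · rintro ⟨-, h⟩
    by_contra hj
    simpa [hv] using h j hj
  · intro hj
    refine ⟨fun i => ?_, fun i hi => ?_⟩
    · rw [hv]
      split_ifs <;> norm_num
    · rw [hv, if_neg]
      rintro rfl
      exact hi hj

theorem coneFace_injective (hv : ∀ i j, f i (v j) = if i = j then 1 else 0) :
    Function.Injective (coneFace f) := by
  intro I J h
  ext j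
  rw [← mem_coneFace_of_dual hv, h, mem_coneFace_of_dual hv]

variable [Fintype ι]

theorem finrank_span_coneFace (hv : ∀ i j, f i (v j) = if i = j then 1 else 0)
    (hf : ∀ x, (∀ i, f i x = 0) → x = 0) (I : Finset ι) :
    finrank ℝ (Submodule.span ℝ (coneFace f I : Set (Fin n → ℝ))) = I.card := by
  have hli : LinearIndependent ℝ v := by
    rw [Fintype.linearIndependent_iff]
    intro g hg i
    have := congrArg (f i) hg
    simpa [map_sum, hv] using this
  have hspan : Submodule.span ℝ (coneFace f I : Set (Fin n → ℝ)) =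
      Submodule.span ℝ (Set.range fun i : I => v i) := by
    refine le_antisymm (Submodule.span_le.2 ?_) (Submodule.span_mono ?_)
    · intro x hx
      have hx' : x = ∑ i, f i x • v i := by
        rw [← sub_eq_zero]
        refine hf _ fun i => ?_
        simp [map_sum, hv]
      rw [hx']
      refine Submodule.sum_mem _ fun i _ => ?_
      by_cases hi : i ∈ I
      · exact Submodule.smul_mem _ _ (Submodule.subset_span ⟨⟨i, hi⟩, rfl⟩)
      · rw [hx.2 i hi, zero_smul]
        exact Submodule.zero_mem _
    · rintro _ ⟨i, rfl⟩
      exact (mem_coneFace_of_dual hv).2 i.2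
  have hli' : LinearIndependent ℝ fun i : I => v i := hli.comp _ Subtype.val_injective
  rw [hspan, finrank_span_eq_card hli', Fintype.card_coe]

theorem numTrivialFaces_eq_card {Q : PointedCone ℝ (Fin n → ℝ)}
    (hQ : ∀ x, x ∈ Q ↔ ∀ i, 0 ≤ f i x) (hv : ∀ i j, f i (v j) = if i = j then 1 else 0)
    (hf : ∀ x, (∀ i, f i x = 0) → x = 0) (k : ℕ) (L : Submodule ℝ (Fin n → ℝ))
    [DecidablePred fun I : Finset ι => ∀ x ∈ coneFace f I, x ∈ L → x = 0] :
    numTrivialFaces k L Q = ((Finset.powersetCard k Finset.univ).filter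
      fun I => ∀ x ∈ coneFace f I, x ∈ L → x = 0).card := by
  rw [numTrivialFaces, ← Set.ncard_coe_finset, ← Set.ncard_image_of_injective _
    (coneFace_injective hv)]
  congr 1
  ext F
  simp only [Set.mem_ofPred_eq, faces, isFaceOf_iff_exists_coneFace f hQ, Set.mem_image,
    Finset.coe_filter, Finset.mem_powersetCard, Finset.subset_univ, true_and]
  constructor
  · rintro ⟨⟨⟨I, rfl⟩, hk⟩, hL⟩
    rw [finrank_span_coneFace hv hf] at hk
    refine ⟨I, ⟨hk, fun x hx hxL => ?_⟩, rfl⟩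
    have : x ∈ ((coneFace f I : Set (Fin n → ℝ)) ∩ (L : Set (Fin n → ℝ))) := ⟨hx, hxL⟩
    rwa [hL] at this
  · rintro ⟨I, ⟨hk, hL⟩, rfl⟩
    refine ⟨⟨⟨I, rfl⟩, by rw [finrank_span_coneFace hv hf, hk]⟩, ?_⟩
    ext x
    refine ⟨fun hx => hL x hx.1 hx.2, ?_⟩
    rintro rfl
    exact ⟨(coneFace f I).zero_mem, L.zero_mem⟩

end SimplicialCone

/-! ### Faces of the Weyl chambers -/

section ChamberFaces

variable {n : ℕ} (ε : Fin n → ℤˣ) (σ : Equiv.Perm (Fin n))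

/-- The signed and permuted coordinates, followed by zeros. -/
def signedCoord (j : ℕ) : Dual ℝ (Fin n → ℝ) :=
  if h : j < n then ((ε ⟨j, h⟩ : ℤ) : ℝ) • LinearMap.proj (σ ⟨j, h⟩) else 0

theorem signedCoord_fin (j : Fin n) (x : Fin n → ℝ) :
    signedCoord ε σ j x = ((ε j : ℤ) : ℝ) * x (σ j) := by
  simp [signedCoord]

theorem signedCoord_of_le {j : ℕ} (h : n ≤ j) (x : Fin n → ℝ) : signedCoord ε σ j x = 0 := by
  simp [signedCoord, h.not_gt]

/-- The differences of consecutive signed coordinates. -/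
def gapForm (j : Fin n) : Dual ℝ (Fin n → ℝ) := signedCoord ε σ j - signedCoord ε σ (j + 1)

theorem gapForm_apply (j : Fin n) (x : Fin n → ℝ) :
    gapForm ε σ j x = signedCoord ε σ j x - signedCoord ε σ (j + 1) x := rfl

theorem antitone_signedCoord {x : Fin n → ℝ} (h : ∀ j, 0 ≤ gapForm ε σ j x) :
    Antitone fun j => signedCoord ε σ j x := by
  refine antitone_nat_of_succ_le fun j => ?_
  rcases lt_or_ge j n with hj | hj
  · have := h ⟨j, hj⟩
    rw [gapForm_apply] at this
    simpa using this
  · rw [signedCoord_of_le ε σ hj, signedCoord_of_le ε σ (by omega)]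

/-- Padding with a zero makes the final inequality a gap inequality too, so `n` forms with dual
basis `gapVector` describe the chamber as a simplicial cone. -/
theorem mem_chamber_iff_gapForm (x : Fin n → ℝ) :
    x ∈ chamber ε σ ↔ ∀ j, 0 ≤ gapForm ε σ j x := by
  rw [mem_chamber_iff]
  constructor
  · rintro ⟨h1, h2⟩ j
    rw [gapForm_apply, sub_nonneg, signedCoord_fin]
    rcases lt_or_ge ((j : ℕ) + 1) n with hj | hj
    · rw [signedCoord_fin ε σ ⟨j + 1, hj⟩]
      exact h1 (Fin.le_def.2 (Nat.le_succ _))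
    · rw [signedCoord_of_le ε σ hj]
      exact h2 j
  · intro h
    have hanti := antitone_signedCoord ε σ h
    constructor
    · intro i j hij
      have := hanti (Fin.le_def.1 hij)
      simpa only [signedCoord_fin] using this
    · intro i
      have := hanti i.2.le
      simpa only [signedCoord_fin, signedCoord_of_le ε σ le_rfl] using this

theorem eq_zero_of_gapForm {x : Fin n → ℝ} (h : ∀ j, gapForm ε σ j x = 0) : x = 0 := by
  have h1 := antitone_signedCoord ε σ (x := x) fun j => (h j).ge
  have h2 := antitone_signedCoord ε σ (x := -x) fun j => by rw [map_neg, h j, neg_zero]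
  have h3 : ∀ j : Fin n, x (σ j) = 0 := by
    intro j
    have e1 := h1 j.2.le
    have e2 := h2 j.2.le
    simp only [map_neg, signedCoord_fin, signedCoord_of_le ε σ le_rfl] at e1 e2
    have : ((ε j : ℤ) : ℝ) * x (σ j) = 0 := by linarith
    exact (mul_eq_zero.1 this).resolve_left (unit_ne_zero _)
  ext i
  have := h3 (σ.symm i)
  rwa [Equiv.apply_symm_apply] at this

/-- The extreme rays of the Weyl chamber. -/
def gapVector (i : Fin n) : Fin n → ℝ :=
  fun m => ((ε (σ.symm m) : ℤ) : ℝ) * if σ.symm m ≤ i then 1 else 0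

theorem signedCoord_gapVector (i : Fin n) (j : ℕ) :
    signedCoord ε σ j (gapVector ε σ i) = if j ≤ i then 1 else 0 := by
  rcases lt_or_ge j n with hj | hj
  · rw [signedCoord_fin ε σ ⟨j, hj⟩, gapVector, Equiv.symm_apply_apply, ← mul_assoc,
      unit_mul_self, one_mul]
    simp [Fin.le_def]
  · rw [signedCoord_of_le ε σ hj, if_neg (by omega)]

theorem gapForm_gapVector (i j : Fin n) :
    gapForm ε σ i (gapVector ε σ j) = if i = j then 1 else 0 := by
  rw [gapForm_apply, signedCoord_gapVector, signedCoord_gapVector]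
  rcases lt_trichotomy i j with h | rfl | h
  · have h' := Fin.lt_def.1 h
    rw [if_pos (by omega), if_pos (by omega), if_neg h.ne, sub_self]
  · simp
  · have h' := Fin.lt_def.1 h
    rw [if_neg (by omega), if_neg (by omega), if_neg h.ne', sub_self]

/-- The number of elements of `I` which are less than `m`. -/
def countBelow (I : Finset (Fin n)) (m : ℕ) : ℕ := (I.filter fun i : Fin n => (i : ℕ) < m).card

theorem countBelow_mono (I : Finset (Fin n)) : Monotone (countBelow I) := by
  intro m m' h
  exact Finset.card_le_card (Finset.monotone_filter_right I fun i _ hi => hi.trans_le h)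

theorem countBelow_succ (I : Finset (Fin n)) (j : Fin n) :
    countBelow I (j + 1) = countBelow I j + if j ∈ I then 1 else 0 := by
  have h : (I.filter fun i : Fin n => (i : ℕ) < j + 1) =
      (I.filter fun i : Fin n => (i : ℕ) < j) ∪ I.filter fun i : Fin n => i = j := by
    ext i
    simp only [Finset.mem_filter, Finset.mem_union, Fin.ext_iff, ← and_or_left]
    exact and_congr_right fun _ => by omega
  rw [countBelow, h, Finset.card_union_of_disjoint]
  · rw [countBelow, Finset.filter_eq']
    split_ifs <;> simp
  · rw [Finset.disjoint_filter]
    rintro i - h1 rfl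
    exact lt_irrefl _ h1

theorem countBelow_self (I : Finset (Fin n)) : countBelow I n = I.card := by
  simp [countBelow]

/-- The index function of the face given by `I`: the blocks are cut off after the elements of
`I`, and what follows the last of them is sent to `⊤`. -/
def blockIndex (k : ℕ) (I : Finset (Fin n)) (j : Fin n) : WithTop (Fin k) :=
  if h : countBelow I j < k then ((⟨countBelow I j, h⟩ : Fin k) : WithTop (Fin k)) else ⊤

theorem blockIndex_eq_coe {k : ℕ} {I : Finset (Fin n)} {j : Fin n} {c : Fin k} :
    blockIndex k I j = c ↔ countBelow I j = c := by
  rw [blockIndex]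
  split_ifs with h
  · rw [WithTop.coe_inj, Fin.ext_iff]
  · constructor
    · intro h'
      exact absurd h' WithTop.top_ne_coe
    · intro h'
      exact absurd (h' ▸ c.2) h

theorem blockIndex_eq_top {k : ℕ} {I : Finset (Fin n)} {j : Fin n} :
    blockIndex k I j = ⊤ ↔ k ≤ countBelow I j := by
  rw [blockIndex]
  split_ifs with h
  · simp [h]
  · simpa using h

theorem monotone_blockIndex (k : ℕ) (I : Finset (Fin n)) : Monotone (blockIndex k I) := by
  intro i j hij
  have h := countBelow_mono I (Fin.le_def.1 hij)
  cases hj : blockIndex k I j with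
  | top => exact le_top
  | coe c =>
    rw [blockIndex_eq_coe] at hj
    have hi : blockIndex k I i = ((⟨countBelow I i, by omega⟩ : Fin k) : WithTop (Fin k)) :=
      blockIndex_eq_coe.2 rfl
    rw [hi, WithTop.coe_le_coe, Fin.le_def]
    change countBelow I i ≤ c
    omega

/-- `countBelow I` is injective on `I` with values below `I.card`, hence takes every such value. -/
theorem exists_mem_countBelow_eq {I : Finset (Fin n)} {c : ℕ} (hc : c < I.card) :
    ∃ j ∈ I, countBelow I j = c := by
  have hlt : ∀ j ∈ I, countBelow I j < I.card := by
    intro j hj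
    have h1 := countBelow_succ I j
    rw [if_pos hj] at h1
    have h2 := countBelow_mono I (Nat.succ_le_of_lt j.2)
    rw [countBelow_self] at h2
    simp only [Nat.succ_eq_add_one] at h2
    omega
  have hinj : Set.InjOn (fun j : Fin n => countBelow I j) I := by
    have key : ∀ i ∈ I, ∀ j : Fin n, i < j → countBelow I i < countBelow I j := by
      intro i hi j hij
      have h1 := countBelow_succ I i
      rw [if_pos hi] at h1
      have h2 := countBelow_mono I (Nat.succ_le_of_lt (Fin.lt_def.1 hij))
      simp only [Nat.succ_eq_add_one] at h2
      omega
    intro i hi j hj hij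
    rcases lt_trichotomy i j with h | h | h
    · exact absurd hij (key i hi j h).ne
    · exact h
    · exact absurd hij (key j hj i h).ne'
  have himg : I.image (fun j : Fin n => countBelow I j) = Finset.range I.card := by
    refine Finset.eq_of_subset_of_card_le ?_ ?_
    · intro m hm
      obtain ⟨j, hj, rfl⟩ := Finset.mem_image.1 hm
      exact Finset.mem_range.2 (hlt j hj)
    · rw [Finset.card_image_of_injOn hinj, Finset.card_range]
  have : c ∈ I.image (fun j : Fin n => countBelow I j) := by rw [himg]; simpa using hc
  simpa using this

/-- No element of `I` lies between the two positions, so every gap between them vanishes. The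
position `n`, where the padded coordinate is zero, is allowed. -/
theorem signedCoord_eq_of_countBelow_eq {I : Finset (Fin n)} {x : Fin n → ℝ}
    (hx : ∀ j ∉ I, gapForm ε σ j x = 0) {m m' : ℕ} (h : countBelow I m = countBelow I m') :
    signedCoord ε σ m x = signedCoord ε σ m' x := by
  wlog hle : m ≤ m' generalizing m m'
  · exact (this h.symm (by omega)).symm
  induction m', hle using Nat.le_induction with
  | base => rfl
  | succ m' hle ih =>
    have h1 := countBelow_mono I hle
    have h2 := countBelow_mono I (Nat.le_succ m')
    simp only [Nat.succ_eq_add_one] at h2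
    rw [ih (by omega)]
    rcases lt_or_ge m' n with hn | hn
    · have h3 := countBelow_succ I ⟨m', hn⟩
      have h4 : (⟨m', hn⟩ : Fin n) ∉ I := by
        intro hmem
        rw [if_pos hmem] at h3
        simp only at h3
        omega
      have := hx _ h4
      rw [gapForm_apply, sub_eq_zero] at this
      exact this
    · rw [signedCoord_of_le ε σ hn, signedCoord_of_le ε σ (by omega)]

theorem antitone_coordOrZero {k : ℕ} {y : Fin k → ℝ} (hy : Antitone y) (hy0 : ∀ c, 0 ≤ y c) :
    Antitone fun o : WithTop (Fin k) => coordOrZero o y := by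
  intro o o' h
  cases o' with
  | top =>
    cases o with
    | top => exact le_rfl
    | coe c => simpa using hy0 c
  | coe c' =>
    cases o with
    | top => simp at h
    | coe c => simpa using hy (WithTop.coe_le_coe.1 h)

theorem coordOrZero_nonneg {k : ℕ} {y : Fin k → ℝ} (hy0 : ∀ c, 0 ≤ y c)
    (o : WithTop (Fin k)) : 0 ≤ coordOrZero o y := by
  cases o with
  | top => simp
  | coe c => simpa using hy0 c

theorem mem_coneFace_gapForm_iff {k : ℕ} {I : Finset (Fin n)} (hI : I.card = k) {x : Fin n → ℝ} :
    x ∈ coneFace (gapForm ε σ) I ↔ ∃ y : Fin k → ℝ, (Antitone y ∧ ∀ c, 0 ≤ y c) ∧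
      spread (blockIndex k I ∘ σ.symm) (ε ∘ σ.symm) y = x := by
  constructor
  · rintro ⟨hx, hx0⟩
    have hanti := antitone_signedCoord ε σ hx
    have hex : ∀ c : Fin k, ∃ j ∈ I, countBelow I j = c := fun c =>
      exists_mem_countBelow_eq (by rw [hI]; exact c.2)
    -- `r c` is the element of `I` that closes block `c`; the value of `x` there becomes the
    -- coordinate `y c`.
    choose r hrI hr using hex
    have hr_mono : Monotone r := by
      intro c c' h
      by_contra hc
      have h1 := countBelow_mono I (Nat.succ_le_of_lt (Fin.lt_def.1 (not_le.1 hc)))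
      have h2 := countBelow_succ I (r c')
      rw [if_pos (hrI c')] at h2
      simp only [Nat.succ_eq_add_one, hr] at h1 h2
      have := Fin.le_def.1 h
      omega
    refine ⟨fun c => signedCoord ε σ (r c) x, ⟨fun c c' h => hanti (Fin.le_def.1 (hr_mono h)),
      fun c => ?_⟩, ?_⟩
    · have := hanti (r c).2.le
      simpa only [signedCoord_of_le ε σ le_rfl] using this
    · ext i
      obtain ⟨j, rfl⟩ := σ.surjective i
      rw [spread_apply]
      simp only [Function.comp_apply, Equiv.symm_apply_apply]
      have h1 : coordOrZero (blockIndex k I j) (fun c => signedCoord ε σ (r c) x) =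
          signedCoord ε σ j x := by
        cases h : blockIndex k I j with
        | top =>
          rw [blockIndex_eq_top] at h
          have h2 := countBelow_mono I j.2.le
          rw [countBelow_self] at h2
          rw [coordOrZero_top, signedCoord_eq_of_countBelow_eq ε σ hx0
            (m := j) (m' := n) (by rw [countBelow_self]; omega), signedCoord_of_le ε σ le_rfl]
        | coe c =>
          rw [blockIndex_eq_coe] at h
          rw [coordOrZero_coe]
          exact signedCoord_eq_of_countBelow_eq ε σ hx0 ((hr c).trans h.symm)
      rw [h1, signedCoord_fin, ← mul_assoc, unit_mul_self, one_mul]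
  · rintro ⟨y, ⟨hy, hy0⟩, rfl⟩
    have h1 : ∀ j : Fin n, signedCoord ε σ j
        (spread (blockIndex k I ∘ σ.symm) (ε ∘ σ.symm) y) = coordOrZero (blockIndex k I j) y := by
      intro j
      rw [signedCoord_fin, spread_apply]
      simp only [Function.comp_apply, Equiv.symm_apply_apply]
      rw [← mul_assoc, unit_mul_self, one_mul]
    refine ⟨fun j => ?_, fun j hj => ?_⟩
    · rw [gapForm_apply, sub_nonneg, h1]
      rcases lt_or_ge ((j : ℕ) + 1) n with hj | hj
      · rw [h1 ⟨j + 1, hj⟩]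
        exact antitone_coordOrZero hy hy0
          (monotone_blockIndex k I (Fin.le_def.2 (Nat.le_succ _)))
      · rw [signedCoord_of_le ε σ hj]
        exact coordOrZero_nonneg hy0 _
    · have h2 := countBelow_succ I j
      rw [if_neg hj, add_zero] at h2
      rw [gapForm_apply, sub_eq_zero, h1]
      rcases lt_or_ge ((j : ℕ) + 1) n with hj' | hj'
      · rw [h1 ⟨j + 1, hj'⟩]
        congr 1
        simp only [blockIndex, h2]
      · have h3 : (j : ℕ) + 1 = n := le_antisymm j.2 hj'
        rw [signedCoord_of_le ε σ hj']
        have : blockIndex k I j = ⊤ := by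
          rw [blockIndex_eq_top, ← h2, h3, countBelow_self, hI]
        rw [this, coordOrZero_top]

end ChamberFaces

/-! ### Monotone index functions -/

open Classical in
/-- The monotone functions to `Fin k ∪ {⊤}` which take all values in `Fin k`. -/
def blockFunctions (n k : ℕ) : Finset (Fin n → WithTop (Fin k)) :=
  Finset.univ.filter fun b => Monotone b ∧ ∀ c : Fin k, ∃ j, b j = c

theorem mem_blockFunctions {n k : ℕ} {b : Fin n → WithTop (Fin k)} :
    b ∈ blockFunctions n k ↔ Monotone b ∧ ∀ c : Fin k, ∃ j, b j = c := by
  simp [blockFunctions]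

theorem countBelow_le {n : ℕ} (I : Finset (Fin n)) (m : ℕ) : countBelow I m ≤ I.card :=
  Finset.card_filter_le _ _

/-- `I` is the set of jumps of `countBelow`; a jump at the last position is visible because the
cardinality is known to be `k`. -/
theorem blockIndex_injOn {n k : ℕ} {I J : Finset (Fin n)} (hI : I.card = k) (hJ : J.card = k)
    (h : blockIndex k I = blockIndex k J) : I = J := by
  have h1 : ∀ j : Fin n, countBelow I j = countBelow J j := by
    intro j
    have hj := congrFun h j
    have hI' := countBelow_le I j
    have hJ' := countBelow_le J j
    cases hb : blockIndex k J j with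
    | top =>
      rw [hb] at hj
      rw [blockIndex_eq_top] at hb hj
      omega
    | coe c =>
      rw [hb] at hj
      rw [blockIndex_eq_coe] at hb hj
      omega
  have h2 : ∀ j : Fin n, countBelow I (j + 1) = countBelow J (j + 1) := by
    intro j
    rcases lt_or_ge ((j : ℕ) + 1) n with hj | hj
    · exact h1 ⟨j + 1, hj⟩
    · rw [show (j : ℕ) + 1 = n from le_antisymm j.2 hj, countBelow_self, countBelow_self, hI, hJ]
  ext j
  have e1 := countBelow_succ I j
  have e2 := countBelow_succ J j
  have e3 := h1 j
  have e4 := h2 j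
  by_cases hi : j ∈ I <;> by_cases hj : j ∈ J <;> simp only [hi, hj, if_true, if_false] at e1 e2 ⊢
  all_goals omega

theorem exists_blockIndex_eq {n k : ℕ} {b : Fin n → WithTop (Fin k)} (hb : Monotone b)
    (hcov : ∀ c : Fin k, ∃ j, b j = c) : ∃ I : Finset (Fin n), I.card = k ∧ blockIndex k I = b := by
  classical
  have hlast : ∀ c : Fin k, ∃ r, b r = c ∧ ∀ i, b i = c → i ≤ r := by
    intro c
    obtain ⟨j, hj⟩ := hcov c
    have hne : (Finset.univ.filter fun i => b i = c).Nonempty := ⟨j, by simpa using hj⟩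
    refine ⟨_, (Finset.mem_filter.1 (Finset.max'_mem _ hne)).2, fun i hi => ?_⟩
    exact Finset.le_max' _ _ (by simpa using hi)
  choose r hr hrmax using hlast
  have hinj : Function.Injective r := by
    intro c c' h
    have := hr c
    rw [h, hr c'] at this
    exact (WithTop.coe_inj.1 this).symm
  refine ⟨Finset.univ.image r, by rw [Finset.card_image_of_injective _ hinj]; simp, ?_⟩
  -- With `I` the set of last positions of the blocks, the elements of `I` before `j` correspond to
  -- the blocks that end before `j`.
  have hcount : ∀ j : Fin n, countBelow (Finset.univ.image r) j =
      (Finset.univ.filter fun c : Fin k => (c : WithTop (Fin k)) < b j).card := by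
    intro j
    rw [countBelow, Finset.filter_image, Finset.card_image_of_injective _ hinj]
    congr 1
    refine Finset.filter_congr fun c _ => ?_
    rw [← Fin.lt_def]
    constructor
    · intro h
      refine lt_of_le_of_ne (hr c ▸ hb h.le) fun h' => ?_
      exact absurd (hrmax c j h'.symm) h.not_ge
    · intro h
      by_contra hc
      have := hb (not_lt.1 hc)
      rw [hr] at this
      exact absurd this h.not_ge
  ext1 j
  cases h : b j with
  | top =>
    rw [blockIndex_eq_top, hcount, h]
    simp
  | coe c =>
    rw [blockIndex_eq_coe, hcount, h]
    simp only [WithTop.coe_lt_coe]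
    rw [Finset.filter_gt_eq_Iio, Fin.card_Iio]

theorem blockIndex_mem {n k : ℕ} {I : Finset (Fin n)} (hI : I.card = k) :
    blockIndex k I ∈ blockFunctions n k := by
  refine mem_blockFunctions.2 ⟨monotone_blockIndex k I, fun c => ?_⟩
  obtain ⟨j, -, hj⟩ := exists_mem_countBelow_eq (I := I) (c := c) (by rw [hI]; exact c.2)
  exact ⟨j, blockIndex_eq_coe.2 hj⟩

theorem sum_blockIndex {n k : ℕ} (g : (Fin n → WithTop (Fin k)) → ℕ) :
    ∑ I ∈ Finset.powersetCard k Finset.univ, g (blockIndex k I) =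
      ∑ b ∈ blockFunctions n k, g b := by
  refine Finset.sum_bij (fun I _ => blockIndex k I) ?_ ?_ ?_ fun _ _ => rfl
  · intro I hI
    exact blockIndex_mem (Finset.mem_powersetCard.1 hI).2
  · intro I hI J hJ h
    exact blockIndex_injOn (Finset.mem_powersetCard.1 hI).2 (Finset.mem_powersetCard.1 hJ).2 h
  · intro b hb
    obtain ⟨h1, h2⟩ := mem_blockFunctions.1 hb
    obtain ⟨I, hI, rfl⟩ := exists_blockIndex_eq h1 h2
    exact ⟨I, Finset.mem_powersetCard.2 ⟨Finset.subset_univ _, hI⟩, rfl⟩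

theorem card_blockFunctions (n k : ℕ) : (blockFunctions n k).card = n.choose k := by
  have := sum_blockIndex (n := n) (k := k) fun _ => 1
  simpa using this.symm

/-- Relabelling the blocks permutes the sorted index functions. -/
theorem sum_blockFunctions_map {n k : ℕ} (G : (Fin n → WithTop (Fin k)) → ℕ)
    (τ : Equiv.Perm (Fin k)) :
    ∑ b ∈ blockFunctions n k, ∑ σ : Equiv.Perm (Fin n), G (WithTop.map τ ∘ b ∘ σ) =
      ∑ b ∈ blockFunctions n k, ∑ σ : Equiv.Perm (Fin n), G (b ∘ σ) := by
  have hmem : ∀ (τ : Equiv.Perm (Fin k)), ∀ b ∈ blockFunctions n k,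
      (WithTop.map τ ∘ b) ∘ Tuple.sort (WithTop.map τ ∘ b) ∈ blockFunctions n k := by
    intro τ b hb
    refine mem_blockFunctions.2 ⟨Tuple.monotone_sort _, fun c => ?_⟩
    obtain ⟨j, hj⟩ := (mem_blockFunctions.1 hb).2 (τ.symm c)
    refine ⟨(Tuple.sort (WithTop.map τ ∘ b)).symm j, ?_⟩
    simp [hj]
  have hinv : ∀ (τ τ' : Equiv.Perm (Fin k)), (∀ c, τ' (τ c) = c) → ∀ b ∈ blockFunctions n k,
      (WithTop.map τ' ∘ ((WithTop.map τ ∘ b) ∘ Tuple.sort (WithTop.map τ ∘ b))) ∘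
        Tuple.sort (WithTop.map τ' ∘ ((WithTop.map τ ∘ b) ∘ Tuple.sort (WithTop.map τ ∘ b))) =
        b := by
    intro τ τ' hτ b hb
    have h : ∀ ρ : Equiv.Perm (Fin n), WithTop.map τ' ∘ ((WithTop.map τ ∘ b) ∘ ρ) = b ∘ ρ := by
      intro ρ
      ext1 j
      simp only [Function.comp_apply]
      cases b (ρ j) with
      | top => rfl
      | coe c => simp [hτ]
    rw [h, Tuple.comp_perm_comp_sort_eq_comp_sort,
      Tuple.sort_eq_refl_iff_monotone.2 (mem_blockFunctions.1 hb).1]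
    rfl
  -- Relabelling destroys monotonicity, so the result is sorted again; the sorting permutation is
  -- absorbed by the sum over `σ`.
  refine Finset.sum_nbij' (fun b => (WithTop.map τ ∘ b) ∘ Tuple.sort (WithTop.map τ ∘ b))
    (fun b => (WithTop.map τ.symm ∘ b) ∘ Tuple.sort (WithTop.map τ.symm ∘ b)) (hmem τ)
    (hmem τ.symm) (hinv τ τ.symm τ.symm_apply_apply) (hinv τ.symm τ τ.apply_symm_apply) ?_
  intro b _
  refine (Fintype.sum_equiv (Equiv.mulLeft (Tuple.sort (WithTop.map τ ∘ b))) _ _ fun σ => ?_).symm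
  rfl

/-! ### Averaging -/

open Classical in
/-- The indicator of the face with parametrization `spread a s` meeting `L` only in `0`. -/
def trivialIndicator {n k : ℕ} (L : Submodule ℝ (Fin n → ℝ)) (a : Fin n → WithTop (Fin k))
    (s : Fin n → ℤˣ) : ℕ :=
  if ∀ y : Fin k → ℝ, Antitone y → (∀ c, 0 ≤ y c) → spread a s y ∈ L → y = 0 then 1 else 0

theorem numTrivialFaces_chamber {n : ℕ} (k : ℕ) (L : Submodule ℝ (Fin n → ℝ))
    (ε : Fin n → ℤˣ) (σ : Equiv.Perm (Fin n)) :
    numTrivialFaces k L (chamber ε σ) =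
      ∑ b ∈ blockFunctions n k, trivialIndicator L (b ∘ σ.symm) (ε ∘ σ.symm) := by
  classical
  rw [numTrivialFaces_eq_card (mem_chamber_iff_gapForm ε σ) (gapForm_gapVector ε σ)
    (fun x => eq_zero_of_gapForm ε σ), Finset.card_filter,
    ← sum_blockIndex fun b => trivialIndicator L (b ∘ σ.symm) (ε ∘ σ.symm)]
  refine Finset.sum_congr rfl fun I hI => ?_
  have hI' := (Finset.mem_powersetCard.1 hI).2
  rw [trivialIndicator]
  refine if_congr ?_ rfl rfl
  have hinj : Function.Injective (spread (blockIndex k I ∘ σ.symm) (ε ∘ σ.symm)) := by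
    refine spread_injective (fun c => ?_) _
    obtain ⟨j, hj⟩ := (mem_blockFunctions.1 (blockIndex_mem hI')).2 c
    exact ⟨σ j, by simpa using hj⟩
  constructor
  · intro h y hy hy0 hyL
    have := h _ ((mem_coneFace_gapForm_iff ε σ hI').2 ⟨y, ⟨hy, hy0⟩, rfl⟩) hyL
    exact hinj (by rw [this, map_zero])
  · intro h x hx hxL
    obtain ⟨y, ⟨hy, hy0⟩, rfl⟩ := (mem_coneFace_gapForm_iff ε σ hI').1 hx
    rw [h y hy hy0 hxL, map_zero]

theorem sum_numTrivialFaces {n : ℕ} (k : ℕ) (L : Submodule ℝ (Fin n → ℝ)) :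
    ∑ ε : Fin n → ℤˣ, ∑ σ : Equiv.Perm (Fin n), numTrivialFaces k L (chamber ε σ) =
      ∑ b ∈ blockFunctions n k, ∑ σ : Equiv.Perm (Fin n), ∑ s : Fin n → ℤˣ,
        trivialIndicator L (b ∘ σ) s := by
  simp only [numTrivialFaces_chamber]
  rw [Finset.sum_comm]
  have h : ∀ σ : Equiv.Perm (Fin n), ∑ ε : Fin n → ℤˣ, ∑ b ∈ blockFunctions n k,
      trivialIndicator L (b ∘ σ.symm) (ε ∘ σ.symm) =
      ∑ b ∈ blockFunctions n k, ∑ s : Fin n → ℤˣ, trivialIndicator L (b ∘ σ.symm) s := by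
    intro σ
    rw [Finset.sum_comm]
    refine Finset.sum_congr rfl fun b _ => ?_
    exact Fintype.sum_equiv (σ.arrowCongr (Equiv.refl ℤˣ)) _ _ fun ε => rfl
  simp only [h]
  rw [Finset.sum_comm]
  refine Finset.sum_congr rfl fun b _ => ?_
  exact Fintype.sum_equiv (Equiv.inv (Equiv.Perm (Fin n))) _ _ fun σ => rfl

/-- The signs `ε`, extended by `1`. -/
def signOrOne {k : ℕ} (ε : Fin k → ℤˣ) (o : WithTop (Fin k)) : ℤˣ :=
  WithTop.recTopCoe (C := fun _ => ℤˣ) 1 ε o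

/-- The relabelling and re-signing of blocks cancels the signed permutation of `x`: the flat is
unchanged, and only the chamber in `ℝ^k` that parametrizes the face varies. -/
theorem spread_pick {n k : ℕ} (a : Fin n → WithTop (Fin k)) (s : Fin n → ℤˣ)
    (p : (Fin k → ℤˣ) × Equiv.Perm (Fin k)) (x : Fin k → ℝ) :
    spread (WithTop.map p.2.symm ∘ a)
      (fun i => s i * signOrOne p.1 (WithTop.map p.2.symm (a i))) (pick p.2 p.1 x) =
      spread a s x := by
  ext i
  rw [spread_apply, spread_apply, Function.comp_apply]
  cases a i with
  | top => simp
  | coe c =>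
    simp only [WithTop.map_coe, coordOrZero_coe, pick_apply, Equiv.apply_symm_apply, signOrOne,
      WithTop.recTopCoe_coe, Units.val_mul, Int.cast_mul]
    rw [mul_assoc, ← mul_assoc ((p.1 _ : ℤ) : ℝ), unit_mul_self, one_mul]

theorem pick_surjective {k : ℕ} (p : (Fin k → ℤˣ) × Equiv.Perm (Fin k)) :
    Function.Surjective (pick p.2 p.1) := by
  intro y
  refine ⟨fun c => ((p.1 (p.2.symm c) : ℤ) : ℝ) * y (p.2.symm c), funext fun c => ?_⟩
  rw [pick_apply, Equiv.symm_apply_apply, ← mul_assoc, unit_mul_self, one_mul]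

theorem pick_injective {k : ℕ} (p : (Fin k → ℤˣ) × Equiv.Perm (Fin k)) :
    Function.Injective (pick p.2 p.1) :=
  LinearMap.injective_iff_surjective.2 (pick_surjective p)

/-- As `p` varies, the faces are the images under one fixed `spread a s` of all chambers of type
`B_k`, so the sum counts the chambers meeting the preimage of `L` trivially. -/
theorem sum_trivialIndicator {n k d : ℕ} (hk : 1 ≤ k) {L : Submodule ℝ (Fin n → ℝ)}
    (hL : InGeneralPosition L d) {a : Fin n → WithTop (Fin k)} (ha : ∀ c : Fin k, ∃ i, a i = c)
    (s : Fin n → ℤˣ) :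
    ∑ p : (Fin k → ℤˣ) × Equiv.Perm (Fin k), trivialIndicator L (WithTop.map p.2.symm ∘ a)
      (fun i => s i * signOrOne p.1 (WithTop.map p.2.symm (a i))) = 2 * alternateSum k d := by
  classical
  rw [← ncard_trivial_chambers hk (hL.comap_spread ha s)]
  simp only [trivialIndicator]
  rw [← Finset.card_filter, ← Set.ncard_coe_finset, Finset.coe_filter]
  congr 1
  ext p
  simp only [Finset.mem_univ, true_and, Set.mem_ofPred_eq, Submodule.mem_comap]
  constructor
  · intro h x hx hxp
    refine pick_injective p ?_
    rw [map_zero]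
    exact h _ hxp.1 hxp.2 (by rwa [spread_pick])
  · intro h y hy hy0 hyL
    obtain ⟨x, rfl⟩ := pick_surjective p y
    rw [spread_pick] at hyL
    rw [h x hyL ⟨hy, hy0⟩, map_zero]

theorem card_mul_sum_numTrivialFaces {n k d : ℕ} (hk : 1 ≤ k) {L : Submodule ℝ (Fin n → ℝ)}
    (hL : InGeneralPosition L d) :
    2 ^ k * k.factorial *
        ∑ ε : Fin n → ℤˣ, ∑ σ : Equiv.Perm (Fin n), numTrivialFaces k L (chamber ε σ) =
      n.choose k * (n.factorial * (2 ^ n * (2 * alternateSum k d))) := by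
  rw [sum_numTrivialFaces, ← card_chambers k, Nat.card_eq_fintype_card, ← smul_eq_mul,
    ← Finset.card_univ, ← Finset.sum_const]
  -- For each `p` the total is invariant: the relabelling permutes the pairs `(b, σ)`, and the extra
  -- signs translate `s`. Summing over `p` first then makes every term the same constant.
  have h : ∀ p : (Fin k → ℤˣ) × Equiv.Perm (Fin k),
      ∑ b ∈ blockFunctions n k, ∑ σ : Equiv.Perm (Fin n), ∑ s : Fin n → ℤˣ,
        trivialIndicator L (b ∘ σ) s =
      ∑ b ∈ blockFunctions n k, ∑ σ : Equiv.Perm (Fin n), ∑ s : Fin n → ℤˣ,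
        trivialIndicator L (WithTop.map p.2.symm ∘ (b ∘ σ))
          (fun i => s i * signOrOne p.1 (WithTop.map p.2.symm ((b ∘ σ) i))) := by
    intro p
    rw [← sum_blockFunctions_map (fun a => ∑ s, trivialIndicator L a s) p.2.symm]
    refine Finset.sum_congr rfl fun b _ => Finset.sum_congr rfl fun σ _ => ?_
    refine (Fintype.sum_equiv (Equiv.mulRight fun i =>
      signOrOne p.1 (WithTop.map p.2.symm ((b ∘ σ) i))) _ _ fun s => ?_).symm
    rfl
  rw [Finset.sum_congr rfl fun p _ => h p, Finset.sum_comm, ← card_blockFunctions n k,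
    ← smul_eq_mul, ← Finset.sum_const]
  refine Finset.sum_congr rfl fun b hb => ?_
  have hσ : n.factorial = (Finset.univ : Finset (Equiv.Perm (Fin n))).card := by
    rw [Finset.card_univ, Fintype.card_perm, Fintype.card_fin]
  have hs : 2 ^ n = (Finset.univ : Finset (Fin n → ℤˣ)).card := by
    rw [Finset.card_univ]
    simp
  rw [Finset.sum_comm, hσ, ← smul_eq_mul, ← Finset.sum_const]
  refine Finset.sum_congr rfl fun σ _ => ?_
  rw [Finset.sum_comm, hs, ← smul_eq_mul, ← Finset.sum_const]
  refine Finset.sum_congr rfl fun s _ => ?_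
  refine sum_trivialIndicator hk hL (fun c => ?_) s
  obtain ⟨j, hj⟩ := (mem_blockFunctions.1 hb).2 c
  exact ⟨σ.symm j, by simpa using hj⟩

end WeylB

end

/-- In `∑ r, B(k, d - 1 - 2r)` all the terms with `r ≥ d` have a negative second index, hence
vanish, so the range of summation `r < d` is no restriction. -/
theorem theorem2p1 (n d k : ℕ) (hk : 1 ≤ k) (hkn : k ≤ n)
    (L : Submodule ℝ (Fin n → ℝ))
    (hcodim : Module.finrank ℝ ((Fin n → ℝ) ⧸ L) = d)
    (hL : WeylB.InGeneralPosition L d) :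
    (1 / ((2 : ℝ) ^ n * (n.factorial : ℝ))) *
        ∑ ε : Fin n → ℤˣ, ∑ σ : Equiv.Perm (Fin n),
          (WeylB.numTrivialFaces k L (WeylB.chamber ε σ) : ℝ)
      = 2 * (n.choose k : ℝ) *
          ((∑ r ∈ Finset.range d, WeylB.B k ((d : ℤ) - 1 - 2 * (r : ℤ)) : ℕ) : ℝ)
          / ((2 : ℝ) ^ k * (k.factorial : ℝ)) := by
  have h := WeylB.card_mul_sum_numTrivialFaces hk hL
  rw [WeylB.alternateSum] at h
  have h' := congrArg (Nat.cast (R := ℝ)) h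
  push_cast at h' ⊢
  have hn : (n.factorial : ℝ) ≠ 0 := by positivity
  have hk' : (k.factorial : ℝ) ≠ 0 := by positivity
  field_simp
  linarith
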